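/- Let $n\ge 1$, $\hbar>0$, $h=2\pi\hbar$, and let $M$ be a positive definite (symmetric) real $2n\times 2n$ matrix. Write $z=(x,p)\in\mathbb{R}^{n}\times\mathbb{R}^n=\mathbb{R}^{2n}$, $\sigma(z,z')=p\cdot x'-p'\cdot x$, $J=\begin{pmatrix}0&I\\-I&0\end{pmatrix}$. The eigenvalues of $JM$ are of the form $\pm i\lambda$ with $\lambda>0$; these $\lambda$ are the symplectic eigenvalues of $M$, and $\lambda_1$ denotes the largest of them. For $\psi\in L^2(\mathbb{R}^n)$ the Wigner transform is $$W\psi(x,p)=\left(\tfrac{1}{2\pi\hbar}\right)^{n}\int_{\mathbb{R}^n}e^{-\frac{i}{\hbar}p\cdot y}\,\psi(x+\tfrac12 y)\,\overline{\psi(x-\tfrac12 y)}\,dy\in\mathbb{R}.$$ A symplectic capacity on $(\mathbb{R}^{2n},\sigma)$ assigns to every subset $\Omega\subset\mathbb{R}^{2n}$ a $c(\Omega)\in[0,\infty]$ such that: (1) $c(f(\Omega))=c(\Omega)$ for every symplectomorphism $f$ of $(\mathbb{R}^{2n},\sigma)$ (smooth diffeomorphism of $\mathbb{R}^{2n}$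 preserving $\sigma$); (2) $c(\Omega)\le c(\Omega')$ if $\Omega\subset\Omega'$; (3) $c(\lambda\Omega)=\lambda^2c(\Omega)$ for every $\lambda\in\mathbb{R}$; (4) $c(\{x_j^2+p_j^2\le r^2\})=c(\{|z|\le r\})=\pi r^2$ for all $j$ and all $r>0$. If (1) is only required for linear symplectomorphisms, $c$ is called a linear symplectic capacity. (Symplectic form of Hardy's uncertainty principle.) Let $\psi\in L^2(\mathbb{R}^n)$, $\psi\ne0$, and assume that there is a constant $C>0$ such that $W\psi(z)\le Ce^{-\frac1\hbar Mz\cdot z}$ for all $z\in\mathbb{R}^{2n}$. Then $c(\mathcal{W}_\Sigma)\ge\frac12h$ for every symplectic capacity $c$, linear or not, where $\mathcal{W}_\Sigma=\{z:\frac12\Sigma^{-1}z\cdot z\le1\}$ is the Wigner ellipsoid of $\Sigma=\frac{\hbar}{2}M^{-1}$; equivalently, $c(\mathcal{B}_M)\ge\frac12h$ where $\mathcal{B}_M=\{z:Mz\cdot z\le\hbar\}$; equivalently, $\lambda_1\le1$. (The three conditions $c(\mathcal{W}_\Sigma)\ge\frac12h$, $c(\mathcal{B}_M)\ge\frac12h$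 and $\lambda_1\le1$ are equivalent for every positive definite $M$ and every such $c$.) -/

import Mathlib

open scoped ENNReal ContDiff Pointwise

noncomputable section

/-- Configuration space `ℝⁿ` with its Euclidean structure and Lebesgue measure. -/
abbrev ConfigSpace (n : ℕ) : Type := EuclideanSpace ℝ (Fin n)

/-- Phase space `ℝ²ⁿ` with the Euclidean norm. A point is `z = (x, p)`; the coordinates
`z (Sum.inl j)` are the positions `x_j`, the coordinates `z (Sum.inr j)` the momenta `p_j`. -/
abbrev PhaseSpace (n : ℕ) : Type := EuclideanSpace ℝ (Fin n ⊕ Fin n)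

/-- The position part `x` of `z = (x, p)`. -/
def PhaseSpace.pos {n : ℕ} (z : PhaseSpace n) : ConfigSpace n :=
  WithLp.toLp 2 (fun j => z (Sum.inl j))

/-- The momentum part `p` of `z = (x, p)`. -/
def PhaseSpace.mom {n : ℕ} (z : PhaseSpace n) : ConfigSpace n :=
  WithLp.toLp 2 (fun j => z (Sum.inr j))

/-- The standard symplectic form `σ(z, z') = p · x' - p' · x`. -/
def symplecticForm {n : ℕ} (z z' : PhaseSpace n) : ℝ :=
  inner ℝ z.mom z'.pos - inner ℝ z'.mom z.pos

/-- The Wigner-Moyal transform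
`W(ψ, φ)(x, p) = (2πħ)⁻ⁿ ∫ exp(-(i/ħ) p·y) ψ(x + y/2) conj (φ(x - y/2)) dy`.
For square integrable `ψ, φ` the integrand is integrable for every `(x, p)`. -/
def wignerMoyal {n : ℕ} (ħ : ℝ) (ψ φ : ConfigSpace n → ℂ) (z : PhaseSpace n) : ℂ :=
  (((1 / (2 * Real.pi * ħ)) ^ n : ℝ) : ℂ) *
    ∫ y : ConfigSpace n,
      Complex.exp (-(Complex.I * ((inner ℝ z.mom y / ħ : ℝ) : ℂ))) *
        ψ (z.pos + (1 / 2 : ℝ) • y) * (starRingEnd ℂ) (φ (z.pos - (1 / 2 : ℝ) • y))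

/-- The Wigner transform `Wψ = W(ψ, ψ)`, as a real-valued function
(`wignerMoyal_self_im` shows that `W(ψ, ψ)` is real). -/
def wigner {n : ℕ} (ħ : ℝ) (ψ : ConfigSpace n → ℂ) (z : PhaseSpace n) : ℝ :=
  (wignerMoyal ħ ψ ψ z).re

theorem wignerMoyal_self_im {n : ℕ} (ħ : ℝ) (ψ : ConfigSpace n → ℂ) (z : PhaseSpace n) :
    (wignerMoyal ħ ψ ψ z).im = 0 := by
  rw [← Complex.conj_eq_iff_im]
  unfold wignerMoyal
  rw [map_mul, Complex.conj_ofReal, ← integral_conj]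
  congr 1
  rw [← MeasureTheory.integral_neg_eq_self]
  congr 1
  funext y
  simp only [map_mul, ← Complex.exp_conj, Complex.conj_I, Complex.conj_ofReal,
    Complex.conj_conj, inner_neg_right, smul_neg, sub_neg_eq_add, ← sub_eq_add_neg, neg_div,
    Complex.ofReal_neg, mul_neg, neg_mul, neg_neg]
  ring

/-- The quadratic form `Mz · z`. -/
def quadForm {n : ℕ} (M : Matrix (Fin n ⊕ Fin n) (Fin n ⊕ Fin n) ℝ) (z : PhaseSpace n) : ℝ :=
  (M.mulVec z) ⬝ᵥ z

/-- The ellipsoid `B_M : Mz · z ≤ ħ`. -/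
def ellipsoidB {n : ℕ} (ħ : ℝ) (M : Matrix (Fin n ⊕ Fin n) (Fin n ⊕ Fin n) ℝ) :
    Set (PhaseSpace n) :=
  {z | quadForm M z ≤ ħ}

/-- The Wigner ellipsoid `W_Σ : (1/2) Σ⁻¹ z · z ≤ 1`; here `A` stands for `Σ`. -/
def wignerEllipsoid {n : ℕ} (A : Matrix (Fin n ⊕ Fin n) (Fin n ⊕ Fin n) ℝ) :
    Set (PhaseSpace n) :=
  {z | (1 / 2) * quadForm A⁻¹ z ≤ 1}

/-- The cylinder `Z_j(r) : x_j² + p_j² ≤ r²`. -/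
def symplecticCylinder {n : ℕ} (j : Fin n) (r : ℝ) : Set (PhaseSpace n) :=
  {z | z (Sum.inl j) ^ 2 + z (Sum.inr j) ^ 2 ≤ r ^ 2}

/-- Symplectomorphisms of `(ℝ²ⁿ, σ)`: smooth diffeomorphisms whose derivative
preserves `σ` at every point. -/
structure IsSymplectomorphism {n : ℕ} (f : PhaseSpace n ≃ PhaseSpace n) : Prop where
  contDiff : ContDiff ℝ ∞ f
  contDiff_symm : ContDiff ℝ ∞ f.symm
  preserves : ∀ z u v : PhaseSpace n,
    symplecticForm (fderiv ℝ f z u) (fderiv ℝ f z v) = symplecticForm u v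

/-- The properties of symplectic capacities other than invariance. -/
structure IsNormalizedMonotone {n : ℕ} (c : Set (PhaseSpace n) → ℝ≥0∞) : Prop where
  mono : ∀ Ω Ω' : Set (PhaseSpace n), Ω ⊆ Ω' → c Ω ≤ c Ω'
  smul : ∀ (t : ℝ) (Ω : Set (PhaseSpace n)), c (t • Ω) = ENNReal.ofReal (t ^ 2) * c Ω
  cylinder : ∀ (j : Fin n) (r : ℝ), 0 < r →
    c (symplecticCylinder j r) = ENNReal.ofReal (Real.pi * r ^ 2)
  ball : ∀ r : ℝ, 0 < r →
    c (Metric.closedBall (0 : PhaseSpace n) r) = ENNReal.ofReal (Real.pi * r ^ 2)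

/-- Symplectic capacities on `(ℝ²ⁿ, σ)`: invariant under all symplectomorphisms. -/
structure IsSymplecticCapacity {n : ℕ} (c : Set (PhaseSpace n) → ℝ≥0∞) : Prop
    extends IsNormalizedMonotone c where
  invariant : ∀ f : PhaseSpace n ≃ PhaseSpace n, IsSymplectomorphism f →
    ∀ Ω : Set (PhaseSpace n), c (f '' Ω) = c Ω

/-- Linear symplectic capacities on `(ℝ²ⁿ, σ)`: invariance is only required under linear
symplectomorphisms. (Those invariant under affine symplectomorphisms are among them.) -/
structure IsLinearSymplecticCapacity {n : ℕ} (c : Set (PhaseSpace n) → ℝ≥0∞) : Prop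
    extends IsNormalizedMonotone c where
  invariant : ∀ S : PhaseSpace n ≃ₗ[ℝ] PhaseSpace n,
    (∀ u v : PhaseSpace n, symplecticForm (S u) (S v) = symplecticForm u v) →
    ∀ Ω : Set (PhaseSpace n), c (S '' Ω) = c Ω

/-- The symplectic eigenvalues of `M`: the numbers `l > 0` such that `i l` is an eigenvalue
of `J M`, where `J = (0, I; -I, 0)`. -/
def symplecticEigenvalues {n : ℕ} (M : Matrix (Fin n ⊕ Fin n) (Fin n ⊕ Fin n) ℝ) : Set ℝ :=
  {l : ℝ | 0 < l ∧ Complex.I * (l : ℂ) ∈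
    spectrum ℂ ((Matrix.fromBlocks 0 1 (-1) 0 * M).map Complex.ofReal)}

end

/-! By Williamson's theorem a symplectic change of variables S turns Mz·z into ∑ dᵢ(xᵢ² + pᵢ²),
where the dᵢ are the symplectic eigenvalues (`symplecticEigenvalues_eq_range`). The ellipsoid ∑
dᵢ(xᵢ² + pᵢ²) ≤ ħ contains a ball and lies in a cylinder, both of squared radius ħ/λ₁. So every
capacity of B_M, linear or not, equals πħ/λ₁ (`capacity_ellipsoidB`), and it is at least h/2 = πħ
exactly when λ₁ ≤ 1. The Wigner ellipsoid is the same set as B_M.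

It remains to see that λ₁ > 1 forces ψ = 0. Smoothing Wψ with exp(-|z|²/ħ) gives, up to a constant,
the squared modulus of the overlap of ψ with a coherent state (the Husimi function). The smoothing
weight is positive, so the one-sided bound on Wψ is enough. If Wψ is bounded by a Gaussian of rate l
> 1 in one complex direction, the overlaps squared have rate close to l/(l+1), hence above 1/2, in
that direction. But the overlap squared is also exp(-|w|²/2ħ) times the squared modulus of an entire
function of w = x - ip. This function tends to 0 along every complex line in the direction, so it
vanishes by Liouville, and Fourier injectivity gives ψ = 0 (`ae_eq_zero_of_coherentIntegrand_bound`,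
`ae_eq_zero_of_wigner_le`).

To reduce a general M to this case, S is taken as TU with T lower triangular and U unitary. T acts
on wave functions by a dilation and a quadratic phase, with no Fourier transform
(`wigner_lowerMetaplectic`). U needs no operator at all: the one-direction argument works for any
unit vector of ℂⁿ, and a column of U is one. -/

namespace Matrix

/-! ### Complex matrices as real matrices commuting with J -/

section Realify

variable {ι : Type*}

/-- The real `2n × 2n` matrix of a complex `n × n` matrix acting on `ζ = x + i p`. -/
def realify (H : Matrix ι ι ℂ) : Matrix (ι ⊕ ι) (ι ⊕ ι) ℝ :=
  fromBlocks (H.map Complex.re) (-(H.map Complex.im)) (H.map Complex.im) (H.map Complex.re)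

theorem realify_mul [Fintype ι] (A B : Matrix ι ι ℂ) : realify (A * B) = realify A * realify B := by
  unfold realify
  rw [fromBlocks_multiply]
  congr 1 <;> ext i j <;>
    simp [mul_apply, Complex.mul_re, Complex.mul_im, Finset.sum_add_distrib,
      Finset.sum_sub_distrib]
  all_goals ring

theorem realify_conjTranspose (A : Matrix ι ι ℂ) : realify Aᴴ = (realify A)ᵀ := by
  unfold realify
  rw [fromBlocks_transpose]
  congr 1 <;> ext i j <;> simp

theorem realify_one [DecidableEq ι] : realify (1 : Matrix ι ι ℂ) = 1 := by
  unfold realify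
  rw [← fromBlocks_one]
  congr 1 <;> ext i j <;> by_cases h : i = j <;> simp [one_apply, h]

theorem realify_diagonal [DecidableEq ι] (d : ι → ℝ) :
    realify (diagonal fun i => (d i : ℂ)) = fromBlocks (diagonal d) 0 0 (diagonal d) := by
  unfold realify
  congr 1 <;> ext i j <;> by_cases h : i = j <;> simp [h]

/-- The matrix `J = (0, I; -I, 0)`. -/
def stdJ (ι : Type*) [DecidableEq ι] : Matrix (ι ⊕ ι) (ι ⊕ ι) ℝ := fromBlocks 0 1 (-1) 0

theorem stdJ_transpose [DecidableEq ι] : (stdJ ι)ᵀ = -stdJ ι := by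
  simp [stdJ, fromBlocks_transpose, fromBlocks_neg]

theorem stdJ_mul_self [Fintype ι] [DecidableEq ι] : stdJ ι * stdJ ι = -1 := by
  simp [stdJ, fromBlocks_multiply, ← fromBlocks_one, fromBlocks_neg]

/-- On ζ = x + ip the matrix J is multiplication by -i, so commuting with J is complex linearity. -/
theorem exists_realify_of_commute [Fintype ι] [DecidableEq ι] {M : Matrix (ι ⊕ ι) (ι ⊕ ι) ℝ}
    (h : M * stdJ ι = stdJ ι * M) : ∃ H : Matrix ι ι ℂ, realify H = M := by
  refine ⟨of fun i j => ⟨M (Sum.inl i) (Sum.inl j), M (Sum.inr i) (Sum.inl j)⟩, ?_⟩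
  rw [← fromBlocks_toBlocks M] at h ⊢
  simp only [stdJ, fromBlocks_multiply, fromBlocks_inj] at h
  simp only [mul_zero, zero_mul, mul_one, one_mul, mul_neg, neg_mul, zero_add, add_zero] at h
  unfold realify
  rw [fromBlocks_inj]
  refine ⟨rfl, ?_, rfl, ?_⟩
  · ext i j
    have := congrFun (congrFun h.1 i) j
    simp at this ⊢
    simp [toBlocks₁₂, toBlocks₂₁] at this ⊢
    linarith
  · rw [h.2.1]; rfl

theorem realify_commute_stdJ [Fintype ι] [DecidableEq ι] (H : Matrix ι ι ℂ) :
    realify H * stdJ ι = stdJ ι * realify H := by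
  simp [realify, stdJ, fromBlocks_multiply]

theorem realify_injective : Function.Injective (realify : Matrix ι ι ℂ → _) := by
  intro A B h
  simp only [realify, fromBlocks_inj] at h
  ext i j
  exact Complex.ext (congrFun (congrFun h.1 i) j) (congrFun (congrFun h.2.2.1 i) j)

end Realify

/-! ### Positive definite square roots -/

section Sqrt

open scoped MatrixOrder

/-- The square root is a function of A in the continuous functional calculus, hence commutes with
whatever A commutes with. -/
theorem PosDef.exists_sqrt {m : Type*} [Fintype m] [DecidableEq m] {A : Matrix m m ℝ}
    (hA : A.PosDef) :
    ∃ R : Matrix m m ℝ, R.PosDef ∧ R * R = A ∧ ∀ B, Commute A B → Commute R B := by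
  have hnn : 0 ≤ A := nonneg_iff_posSemidef.2 hA.posSemidef
  have hs : CFC.sqrt A * CFC.sqrt A = A := CFC.sqrt_mul_sqrt_self A hnn
  refine ⟨CFC.sqrt A, ?_, hs, fun B hB => ?_⟩
  · refine ((nonneg_iff_posSemidef.1 (CFC.sqrt_nonneg A)).posDef_iff_det_ne_zero).2 fun h => ?_
    have := congrArg det hs
    rw [det_mul, h, zero_mul] at this
    exact hA.det_pos.ne this
  · rw [CFC.sqrt_eq_nnrpow]
    exact Commute.cfcₙ_nnreal hB _

end Sqrt

end Matrix

/-! ### Williamson's theorem with a lower triangular symplectic factor -/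

namespace Matrix

theorem PosDef.transpose_eq {m : Type*} {A : Matrix m m ℝ} (hA : A.PosDef) : Aᵀ = A := by
  rw [← conjTranspose_eq_transpose_of_trivial]
  exact hA.isHermitian

variable {ι : Type*} [Fintype ι] [DecidableEq ι]

theorem isUnit_stdJ : IsUnit (stdJ ι) :=
  IsUnit.of_mul_eq_one (-stdJ ι) (by rw [mul_neg, stdJ_mul_self, neg_neg])

/-- With R the square root of M, the matrix N = RJR is antisymmetric and invertible, and its polar
part P = |N| commutes with it. The witness is G = R⁻¹PR⁻¹. Once G is factored as TTᵀ with T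
symplectic, the last identity says that TᵀMT commutes with J. -/
theorem PosDef.exists_symplectic_commute {M : Matrix (ι ⊕ ι) (ι ⊕ ι) ℝ} (hM : M.PosDef) :
    ∃ G : Matrix (ι ⊕ ι) (ι ⊕ ι) ℝ, G.PosDef ∧ G * stdJ ι * G = stdJ ι ∧
      G * M * stdJ ι = stdJ ι * M * G := by
  obtain ⟨R, hR, hRM, -⟩ := hM.exists_sqrt
  have hRt : Rᵀ = R := hR.transpose_eq
  have hQR : R⁻¹ * R = 1 := nonsing_inv_mul R ((isUnit_iff_isUnit_det R).1 hR.isUnit)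
  have hRQ : R * R⁻¹ = 1 := mul_nonsing_inv R ((isUnit_iff_isUnit_det R).1 hR.isUnit)
  have hQ : R⁻¹.PosDef := hR.inv
  have hQt : (R⁻¹)ᵀ = R⁻¹ := hQ.transpose_eq
  generalize R⁻¹ = Q at *
  set J := stdJ ι with hJ
  have hJt : Jᵀ = -J := stdJ_transpose
  have hJJ : J * J = -1 := stdJ_mul_self
  obtain ⟨N, hN⟩ : ∃ N, N = R * J * R := ⟨_, rfl⟩
  -- -N² is the congruence (JR)ᵀM(JR) of M.
  have hNN : (-(N * N)).PosDef := by
    have h := (IsUnit.posDef_star_left_conjugate_iff (x := M) (isUnit_stdJ.mul hR.isUnit)).2 hM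
    convert h using 1
    rw [star_eq_conjTranspose, conjTranspose_eq_transpose_of_trivial, transpose_mul, ← hJ, hRt,
      hJt, hN, ← hRM]
    noncomm_ring
  obtain ⟨P, hP, hPP, hPc⟩ := hNN.exists_sqrt
  have hPN : P * N = N * P := hPc N (by simp [Commute, SemiconjBy, mul_assoc])
  -- K is -N⁻¹, so P commutes with it too, and PKP = P²K = -N²K = N.
  obtain ⟨K, hK⟩ : ∃ K, K = Q * J * Q := ⟨_, rfl⟩
  have hNK : N * K = -1 := by
    calc N * K = R * J * (R * Q) * J * Q := by rw [hN, hK]; noncomm_ring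
      _ = R * (J * J) * Q := by rw [hRQ]; noncomm_ring
      _ = -1 := by rw [hJJ]; simp [hRQ]
  have hKN : K * N = -1 := by
    calc K * N = Q * J * (Q * R) * J * R := by rw [hN, hK]; noncomm_ring
      _ = Q * (J * J) * R := by rw [hQR]; noncomm_ring
      _ = -1 := by rw [hJJ]; simp [hQR]
  have hKP : K * P = P * K := by
    have h : K * (P * N) * K = K * (N * P) * K := by rw [hPN]
    have h1 : K * (P * N) * K = -(K * P) := by
      calc K * (P * N) * K = K * P * (N * K) := by noncomm_ring
        _ = _ := by rw [hNK]; simp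
    have h2 : K * (N * P) * K = -(P * K) := by
      calc K * (N * P) * K = (K * N) * P * K := by noncomm_ring
        _ = _ := by rw [hKN]; simp
    rw [h1, h2] at h
    exact neg_injective h
  refine ⟨Q * P * Q, ?_, ?_, ?_⟩
  · have h := (IsUnit.posDef_star_left_conjugate_iff (x := P) hQ.isUnit).2 hP
    rwa [star_eq_conjTranspose, conjTranspose_eq_transpose_of_trivial, hQt] at h
  · calc Q * P * Q * J * (Q * P * Q) = Q * (P * (Q * J * Q) * P) * Q := by noncomm_ring
      _ = Q * (P * P * K) * Q := by rw [← hK, mul_assoc P K P, hKP, mul_assoc P P K]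
      _ = Q * -(N * (N * K)) * Q := by rw [hPP]; noncomm_ring
      _ = (Q * R) * J * (R * Q) := by rw [hNK, hN]; noncomm_ring
      _ = J := by rw [hQR, hRQ]; simp
  · calc Q * P * Q * M * J = Q * P * (Q * R) * R * J := by rw [← hRM]; noncomm_ring
      _ = Q * P * R * J * (R * Q) := by rw [hQR, hRQ]; simp
      _ = Q * (P * N) * Q := by rw [hN]; noncomm_ring
      _ = (Q * R) * J * R * P * Q := by rw [hPN, hN]; noncomm_ring
      _ = J * R * (R * Q) * P * Q := by rw [hQR, hRQ]; simp
      _ = J * M * (Q * P * Q) := by rw [← hRM]; noncomm_ring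

/-- The lower triangular symplectic matrix `(x, p) ↦ (L x, L⁻¹ (p - Y x))`
for symmetric `L` and `Y`. -/
noncomputable def lowerSymplectic (L Y : Matrix ι ι ℝ) : Matrix (ι ⊕ ι) (ι ⊕ ι) ℝ :=
  fromBlocks L 0 (-(L⁻¹ * Y)) L⁻¹

theorem lowerSymplectic_symplectic {L Y : Matrix ι ι ℝ} (hL : IsUnit L.det) (hLt : Lᵀ = L)
    (hYt : Yᵀ = Y) :
    (lowerSymplectic L Y)ᵀ * stdJ ι * lowerSymplectic L Y = stdJ ι := by
  simp only [lowerSymplectic, stdJ, fromBlocks_transpose, fromBlocks_multiply, transpose_neg,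
    transpose_mul, transpose_nonsing_inv, hLt, hYt]
  simp [nonsing_inv_mul L hL, mul_nonsing_inv L hL, ← Matrix.mul_assoc]
  simp [Matrix.mul_assoc, nonsing_inv_mul L hL]

/-- A block Cholesky factorization: L is the square root of the upper left block D, and the lower
left block F fixes Y. Of the relations in GJG = J, ED = DF makes Y symmetric, and DA = 1 + E² makes
the remaining block of the product equal to A. -/
theorem PosDef.exists_eq_lowerSymplectic {G : Matrix (ι ⊕ ι) (ι ⊕ ι) ℝ} (hG : G.PosDef)
    (hs : G * stdJ ι * G = stdJ ι) :
    ∃ L Y : Matrix ι ι ℝ, L.PosDef ∧ Yᵀ = Y ∧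
      G = lowerSymplectic L Y * (lowerSymplectic L Y)ᵀ := by
  have hGt : Gᵀ = G := hG.transpose_eq
  obtain ⟨D, E, F, A, rfl⟩ : ∃ D E F A, G = fromBlocks D E F A :=
    ⟨_, _, _, _, (fromBlocks_toBlocks G).symm⟩
  have hD : D.PosDef := hG.submatrix (e := Sum.inl) Sum.inl_injective
  rw [fromBlocks_transpose, fromBlocks_inj] at hGt
  obtain ⟨hDt, hFE, -, hAt⟩ := hGt
  obtain ⟨L, hL, hLD, -⟩ := hD.exists_sqrt
  have hLt : Lᵀ = L := hL.transpose_eq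
  have hLu := (isUnit_iff_isUnit_det L).1 hL.isUnit
  simp only [stdJ, fromBlocks_multiply, fromBlocks_inj, mul_zero, mul_one, mul_neg,
    neg_mul, zero_add, add_zero] at hs
  obtain ⟨h1, h2, h3, h4⟩ := hs
  have hEF : E * D = D * F := by
    have := h1; rw [neg_add_eq_zero] at this; exact this
  have hQt : (L⁻¹)ᵀ = L⁻¹ := by rw [transpose_nonsing_inv, hLt]
  have hQL : L⁻¹ * L = 1 := nonsing_inv_mul L hLu
  have hLQ : L * L⁻¹ = 1 := mul_nonsing_inv L hLu
  refine ⟨L, -(L * F * L⁻¹), hL, ?_, ?_⟩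
  · rw [transpose_neg, transpose_mul, transpose_mul, hQt, hLt, hFE, neg_inj]
    calc L⁻¹ * (E * L) = L⁻¹ * E * (L * L) * L⁻¹ := by
          rw [mul_assoc (L⁻¹ * E), mul_assoc L, hLQ, mul_one, mul_assoc]
      _ = L⁻¹ * (E * D) * L⁻¹ := by rw [hLD]; noncomm_ring
      _ = (L⁻¹ * L) * (L * F * L⁻¹) := by rw [hEF, ← hLD]; noncomm_ring
      _ = _ := by rw [hQL, one_mul]
  · have hT : -(L⁻¹ * -(L * F * L⁻¹)) = F * L⁻¹ := by
      calc -(L⁻¹ * -(L * F * L⁻¹)) = (L⁻¹ * L) * F * L⁻¹ := by noncomm_ring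
        _ = _ := by rw [hQL, one_mul]
    rw [lowerSymplectic, hT]
    simp only [fromBlocks_transpose, fromBlocks_multiply, fromBlocks_inj, transpose_mul, hQt, hLt]
    refine ⟨by simp [hLD], ?_, ?_, ?_⟩
    · rw [← Matrix.mul_assoc, hLQ]; simp [hFE]
    · rw [Matrix.mul_assoc, hQL]; simp
    · have hDi : L⁻¹ * L⁻¹ * D = 1 := by
        rw [← hLD]
        calc L⁻¹ * L⁻¹ * (L * L) = L⁻¹ * (L⁻¹ * L) * L := by noncomm_ring
          _ = 1 := by rw [hQL, mul_one, hQL]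
      have hDi' : D * (L⁻¹ * L⁻¹) = 1 := mul_eq_one_comm.1 hDi
      have h5 : D * A = 1 + E * E := by
        rw [← h2]; abel
      have hFt : Fᵀ = E := hFE
      rw [hFt]
      calc A = L⁻¹ * L⁻¹ * (D * A) := by rw [← Matrix.mul_assoc, hDi, one_mul]
        _ = L⁻¹ * L⁻¹ * (E * D) * (L⁻¹ * L⁻¹) * E + L⁻¹ * L⁻¹ := by
          rw [h5, Matrix.mul_assoc _ _ (L⁻¹ * L⁻¹), Matrix.mul_assoc E, hDi']; noncomm_ring
        _ = L⁻¹ * L⁻¹ * D * (F * (L⁻¹ * L⁻¹ * E)) + L⁻¹ * L⁻¹ := by rw [hEF]; noncomm_ring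
        _ = _ := by rw [hDi]; noncomm_ring

/-- **Williamson's theorem**, with the symplectic matrix in Iwasawa form. -/
theorem PosDef.exists_williamson {M : Matrix (ι ⊕ ι) (ι ⊕ ι) ℝ} (hM : M.PosDef) :
    ∃ (L Y : Matrix ι ι ℝ) (U : Matrix ι ι ℂ) (d : ι → ℝ), L.PosDef ∧ Yᵀ = Y ∧
      U ∈ unitaryGroup ι ℂ ∧ (∀ i, 0 < d i) ∧
      (lowerSymplectic L Y)ᵀ * M * lowerSymplectic L Y =
        realify U * fromBlocks (diagonal d) 0 0 (diagonal d) * (realify U)ᵀ := by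
  obtain ⟨G, hG, hGJ, hGM⟩ := hM.exists_symplectic_commute
  obtain ⟨L, Y, hL, hY, rfl⟩ := hG.exists_eq_lowerSymplectic hGJ
  have hLt : Lᵀ = L := hL.transpose_eq
  have hLu := (isUnit_iff_isUnit_det L).1 hL.isUnit
  have hT := lowerSymplectic_symplectic hLu hLt hY
  generalize hTd : lowerSymplectic L Y = T at *
  have hMt : Mᵀ = M := hM.transpose_eq
  set J := stdJ ι with hJ
  have hJJ : J * J = -1 := stdJ_mul_self
  have hTu : IsUnit T := by
    refine IsUnit.of_mul_eq_one (-(J * Tᵀ * J)) (mul_eq_one_comm.1 ?_)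
    calc -(J * Tᵀ * J) * T = -(J * (Tᵀ * J * T)) := by noncomm_ring
      _ = 1 := by rw [hT, hJJ, neg_neg]
  have hTJ : T * J * Tᵀ = J := by
    have h : (T * J * Tᵀ) * J * (T * J) = J * J * (T * J) := by
      calc _ = T * J * (Tᵀ * J * T) * J := by noncomm_ring
        _ = _ := by rw [hT, mul_assoc T J J, hJJ]; simp
    have h2 := (hTu.mul isUnit_stdJ).mul_right_cancel h
    exact isUnit_stdJ.mul_right_cancel h2
  -- Multiplied by T on the left and Tᵀ on the right, this is the relation between G = TTᵀ, M and J.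
  have hc : (Tᵀ * M * T) * J = J * (Tᵀ * M * T) := by
    have hTt : IsUnit Tᵀ := (isUnit_iff_isUnit_det _).2
      (by rw [det_transpose]; exact (isUnit_iff_isUnit_det _).1 hTu)
    apply hTu.mul_left_cancel
    apply hTt.mul_right_cancel
    calc T * ((Tᵀ * M * T) * J) * Tᵀ = T * Tᵀ * M * (T * J * Tᵀ) := by noncomm_ring
      _ = (T * J * Tᵀ) * M * (T * Tᵀ) := by rw [hTJ, hGM]
      _ = _ := by noncomm_ring
  -- Symmetric and complex linear means Hermitian, so the complex spectral theorem supplies U and d;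
  -- positivity of d follows by congruence with M.
  obtain ⟨H, hH⟩ := exists_realify_of_commute hc
  have hHh : H.IsHermitian := by
    apply realify_injective
    rw [realify_conjTranspose, hH]
    simp [hMt, mul_assoc]
  have hU := hHh.eigenvectorUnitary.2
  have hH2 : realify H = realify (hHh.eigenvectorUnitary : Matrix ι ι ℂ) *
      fromBlocks (diagonal hHh.eigenvalues) 0 0 (diagonal hHh.eigenvalues) *
      (realify (hHh.eigenvectorUnitary : Matrix ι ι ℂ))ᵀ := by
    conv_lhs => rw [hHh.spectral_theorem, Unitary.conjStarAlgAut_apply]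
    rw [realify_mul, realify_mul, star_eq_conjTranspose, realify_conjTranspose,
      ← realify_diagonal]
    rfl
  refine ⟨L, Y, hHh.eigenvectorUnitary, hHh.eigenvalues, hL, hY, hU, ?_,
    by rw [hTd, ← hH, hH2]⟩
  have hpos : (fromBlocks (diagonal hHh.eigenvalues) 0 0 (diagonal hHh.eigenvalues) :
      Matrix (ι ⊕ ι) (ι ⊕ ι) ℝ).PosDef := by
    have h1 := (IsUnit.posDef_star_left_conjugate_iff (x := M) hTu).2 hM
    rw [star_eq_conjTranspose, conjTranspose_eq_transpose_of_trivial, ← hH, hH2] at h1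
    generalize (hHh.eigenvectorUnitary : Matrix ι ι ℂ) = U at *
    have hUu : IsUnit (realify U) := by
      refine IsUnit.of_mul_eq_one (realify Uᴴ) ?_
      rw [← realify_mul, ← star_eq_conjTranspose, mem_unitaryGroup_iff.1 hU, realify_one]
    rw [← IsUnit.posDef_star_right_conjugate_iff hUu]
    simpa [star_eq_conjTranspose, conjTranspose_eq_transpose_of_trivial] using h1
  intro i
  simpa using hpos.diag_pos (i := Sum.inl i)

end Matrix

/-! ### Symplectic eigenvalues, and the capacity of an ellipsoid -/

open Matrix

theorem symplecticForm_eq_dotProduct {n : ℕ} (u v : PhaseSpace n) :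
    symplecticForm u v = -((u : Fin n ⊕ Fin n → ℝ) ⬝ᵥ (stdJ (Fin n)).mulVec v) := by
  simp only [symplecticForm, PhaseSpace.mom, PhaseSpace.pos, dotProduct, Fintype.sum_sum_type,
    stdJ, mulVec, PiLp.inner_apply]
  simp [Matrix.one_apply, mul_comm]
  ring

/-- A linear symplectic map is smooth and is its own derivative; hence only linear capacities have
to be treated. -/
theorem IsSymplecticCapacity.isLinearSymplecticCapacity {n : ℕ} {c : Set (PhaseSpace n) → ℝ≥0∞}
    (hc : IsSymplecticCapacity c) : IsLinearSymplecticCapacity c where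
  toIsNormalizedMonotone := hc.toIsNormalizedMonotone
  invariant S hS Ω := by
    have hd : ∀ z, fderiv ℝ S z = S.toContinuousLinearEquiv := fun z =>
      S.toContinuousLinearEquiv.toContinuousLinearMap.hasFDerivAt.fderiv
    refine hc.invariant S.toEquiv ⟨?_, ?_, ?_⟩ Ω
    · exact S.toContinuousLinearEquiv.contDiff
    · exact S.symm.toContinuousLinearEquiv.contDiff
    · intro z u v
      change symplecticForm (fderiv ℝ S z u) (fderiv ℝ S z v) = _
      rw [hd]
      exact hS u v

section

variable {n : ℕ} {M S : Matrix (Fin n ⊕ Fin n) (Fin n ⊕ Fin n) ℝ} {d : Fin n → ℝ}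

theorem isUnit_of_symplectic (hS : Sᵀ * stdJ (Fin n) * S = stdJ (Fin n)) : IsUnit S := by
  refine IsUnit.of_mul_eq_one (-(stdJ (Fin n) * Sᵀ * stdJ (Fin n))) (mul_eq_one_comm.1 ?_)
  calc _ = -(stdJ (Fin n) * (Sᵀ * stdJ (Fin n) * S)) := by noncomm_ring
    _ = 1 := by rw [hS, stdJ_mul_self, neg_neg]

theorem symplectic_transpose (hS : Sᵀ * stdJ (Fin n) * S = stdJ (Fin n)) :
    S * stdJ (Fin n) * Sᵀ = stdJ (Fin n) := by
  have h : (S * stdJ (Fin n) * Sᵀ) * (stdJ (Fin n) * S) = stdJ (Fin n) * (stdJ (Fin n) * S) := by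
    calc _ = S * stdJ (Fin n) * (Sᵀ * stdJ (Fin n) * S) := by noncomm_ring
      _ = _ := by rw [hS, mul_assoc S, ← mul_assoc _ _ S, stdJ_mul_self]; simp
  exact (isUnit_stdJ.mul (isUnit_of_symplectic hS)).mul_right_cancel h

/-- S conjugates JM to the matrix with off-diagonal blocks d and -d, whose eigenvalues are ±i dᵢ. -/
theorem symplecticEigenvalues_eq_range (hS : Sᵀ * stdJ (Fin n) * S = stdJ (Fin n))
    (hMS : Sᵀ * M * S = fromBlocks (diagonal d) 0 0 (diagonal d)) (hd : ∀ i, 0 < d i) :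
    symplecticEigenvalues M = Set.range d := by
  have hSu := isUnit_of_symplectic hS
  have hconj : stdJ (Fin n) * M * S = S * fromBlocks 0 (diagonal d) (-diagonal d) 0 := by
    calc stdJ (Fin n) * M * S = S * (stdJ (Fin n) * (Sᵀ * M * S)) := by
          conv_lhs => rw [← symplectic_transpose hS]
          noncomm_ring
      _ = _ := by rw [hMS, stdJ, fromBlocks_multiply]; simp
  have key : ∀ μ : ℂ, μ ∈ spectrum ℂ ((stdJ (Fin n) * M).map Complex.ofReal) ↔
      ∃ i, μ * μ + (d i : ℂ) * d i = 0 := by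
    intro μ
    have hSc : IsUnit (S.map Complex.ofReal) := hSu.map (Complex.ofRealHom.mapMatrix)
    have hm : (algebraMap ℂ _ μ - (stdJ (Fin n) * M).map Complex.ofReal) * S.map Complex.ofReal =
        S.map Complex.ofReal * (algebraMap ℂ _ μ -
          (fromBlocks 0 (diagonal d) (-diagonal d) 0).map Complex.ofReal) := by
      have h := congrArg (Complex.ofRealHom.mapMatrix) hconj
      simp only [map_mul (Complex.ofRealHom.mapMatrix)] at h
      rw [sub_mul, mul_sub, Algebra.commutes]
      congr 1
      rw [← map_mul (Complex.ofRealHom.mapMatrix)] at h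
      exact h
    have hiff : IsUnit (algebraMap ℂ _ μ - (stdJ (Fin n) * M).map Complex.ofReal) ↔
        IsUnit (algebraMap ℂ (Matrix (Fin n ⊕ Fin n) (Fin n ⊕ Fin n) ℂ) μ -
          (fromBlocks 0 (diagonal d) (-diagonal d) 0).map Complex.ofReal) := by
      rw [isUnit_iff_isUnit_det, isUnit_iff_isUnit_det]
      have h := congrArg det hm
      rw [det_mul, det_mul, mul_comm] at h
      rw [mul_left_cancel₀ ((isUnit_iff_isUnit_det _).1 hSc).ne_zero h]
    have hb : algebraMap ℂ (Matrix (Fin n ⊕ Fin n) (Fin n ⊕ Fin n) ℂ) μ -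
          (fromBlocks 0 (diagonal d) (-diagonal d) 0).map Complex.ofReal =
        fromBlocks (diagonal fun _ => μ) (-diagonal fun i => (d i : ℂ))
          (diagonal fun i => (d i : ℂ)) (diagonal fun _ => μ) := by
      ext i j
      rcases i with i | i <;> rcases j with j | j <;> by_cases h : i = j <;>
        simp [algebraMap_matrix_apply, h]
    rw [spectrum.mem_iff, hiff, hb, isUnit_iff_isUnit_det, isUnit_iff_ne_zero, not_not]
    set X := fromBlocks (diagonal fun _ : Fin n => μ) (-diagonal fun i => (d i : ℂ))
      (diagonal fun i => (d i : ℂ)) (diagonal fun _ => μ) with hX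
    -- X Xᵀ is block diagonal, so det X squared is the square of ∏(μ² + dᵢ²), which is enough to
    -- locate the zeros of det X.
    have hXX : X * Xᵀ = fromBlocks (diagonal fun i => μ * μ + (d i : ℂ) * d i) 0 0
        (diagonal fun i => μ * μ + (d i : ℂ) * d i) := by
      rw [hX, fromBlocks_transpose, fromBlocks_multiply, fromBlocks_inj]
      simp [add_comm, mul_comm]
    have hdet := congrArg det hXX
    rw [det_mul, det_transpose, det_fromBlocks_zero₂₁, det_diagonal] at hdet
    rw [← mul_self_eq_zero, hdet, mul_self_eq_zero, Finset.prod_eq_zero_iff]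
    simp
  ext l
  change 0 < l ∧ _ ∈ spectrum ℂ ((stdJ (Fin n) * M).map Complex.ofReal) ↔ _
  rw [key]
  constructor
  · rintro ⟨hl, i, hi⟩
    have h : (d i : ℂ) * d i = l * l := by linear_combination hi - (l : ℂ) ^ 2 * Complex.I_sq
    exact ⟨i, (mul_self_inj (hd i).le hl.le).1 (by exact_mod_cast h)⟩
  · rintro ⟨i, rfl⟩
    exact ⟨hd i, i, by linear_combination (d i : ℂ) ^ 2 * Complex.I_sq⟩

theorem quadForm_eq (M : Matrix (Fin n ⊕ Fin n) (Fin n ⊕ Fin n) ℝ) (z : PhaseSpace n) :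
    quadForm M z = (z : Fin n ⊕ Fin n → ℝ) ⬝ᵥ M.mulVec z := dotProduct_comm _ _

theorem wignerEllipsoid_eq_ellipsoidB {ħ : ℝ} (hħ : 0 < ħ) (hM : M.PosDef) :
    wignerEllipsoid ((ħ / 2) • M⁻¹) = ellipsoidB ħ M := by
  have hu := (isUnit_iff_isUnit_det M).1 hM.isUnit
  have h : ((ħ / 2) • M⁻¹)⁻¹ = (2 / ħ) • M := by
    apply inv_eq_left_inv
    rw [smul_mul_smul_comm, mul_nonsing_inv M hu]
    field_simp
    simp
  ext z
  simp only [wignerEllipsoid, ellipsoidB, Set.mem_ofPred_eq, h, quadForm, smul_mulVec,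
    smul_dotProduct, smul_eq_mul]
  rw [← mul_assoc, show (1 / 2 : ℝ) * (2 / ħ) = 1 / ħ by field_simp, one_div, inv_mul_le_iff₀ hħ,
    mul_one]

/-- After the symplectic change of variables the ellipsoid lies between the ball and the k-th
cylinder of the same radius √(ħ/d k). Maximality of d k gives the ball, and dropping all terms but
the k-th gives the cylinder. -/
theorem capacity_ellipsoidB {ħ : ℝ} (hħ : 0 < ħ) (hS : Sᵀ * stdJ (Fin n) * S = stdJ (Fin n))
    (hMS : Sᵀ * M * S = fromBlocks (diagonal d) 0 0 (diagonal d)) (hd : ∀ i, 0 < d i)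
    {k : Fin n} (hk : ∀ i, d i ≤ d k) {c : Set (PhaseSpace n) → ℝ≥0∞}
    (hc : IsLinearSymplecticCapacity c) :
    c (ellipsoidB ħ M) = ENNReal.ofReal (Real.pi * (ħ / d k)) := by
  have hSu := (isUnit_iff_isUnit_det S).1 (isUnit_of_symplectic hS)
  let e : PhaseSpace n ≃ₗ[ℝ] PhaseSpace n :=
    (WithLp.linearEquiv 2 ℝ _).trans ((toLin'OfInv (nonsing_inv_mul S hSu)
      (mul_nonsing_inv S hSu)).trans (WithLp.linearEquiv 2 ℝ _).symm)
  have he : ∀ z, (e z : Fin n ⊕ Fin n → ℝ) = S.mulVec z := fun z => rfl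
  have hpre : ∀ z : PhaseSpace n, quadForm M (e z) =
      ∑ i, d i * (z (Sum.inl i) ^ 2 + z (Sum.inr i) ^ 2) := by
    intro z
    rw [quadForm_eq, he, mulVec_mulVec, dotProduct_mulVec, ← vecMul_transpose, vecMul_vecMul,
      ← Matrix.mul_assoc, hMS, ← dotProduct_mulVec]
    simp only [dotProduct, Fintype.sum_sum_type, mulVec, fromBlocks, diagonal]
    simp [mul_add, Finset.sum_add_distrib]
    congr 1 <;> exact Finset.sum_congr rfl fun i _ => by ring
  have himg : ellipsoidB ħ M =
      e '' {z | ∑ i, d i * (z (Sum.inl i) ^ 2 + z (Sum.inr i) ^ 2) ≤ ħ} := by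
    ext z
    constructor
    · intro hz
      refine ⟨e.symm z, ?_, e.apply_symm_apply z⟩
      rw [Set.mem_ofPred_eq, ← hpre, e.apply_symm_apply]
      exact hz
    · rintro ⟨w, hw, rfl⟩
      rw [Set.mem_ofPred_eq, ← hpre] at hw
      exact hw
  rw [himg, hc.invariant e]
  · have hr : 0 < Real.sqrt (ħ / d k) := Real.sqrt_pos.2 (div_pos hħ (hd k))
    have hr2 : Real.sqrt (ħ / d k) ^ 2 = ħ / d k := Real.sq_sqrt (div_pos hħ (hd k)).le
    apply le_antisymm
    · rw [← hr2, ← hc.cylinder k _ hr]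
      apply hc.mono
      intro z hz
      rw [symplecticCylinder, Set.mem_ofPred_eq, hr2, le_div_iff₀ (hd k), mul_comm]
      refine le_trans ?_ hz
      exact Finset.single_le_sum (f := fun i => d i * (z (Sum.inl i) ^ 2 + z (Sum.inr i) ^ 2))
        (fun i _ => mul_nonneg (hd i).le (by positivity)) (Finset.mem_univ k)
    · rw [← hr2, ← hc.ball _ hr]
      apply hc.mono
      intro z hz
      rw [mem_closedBall_zero_iff, ← sq_le_sq₀ (norm_nonneg _) hr.le, hr2,
        EuclideanSpace.norm_sq_eq, le_div_iff₀ (hd k), mul_comm] at hz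
      refine le_trans ?_ hz
      rw [Fintype.sum_sum_type, ← Finset.sum_add_distrib, Finset.mul_sum]
      refine Finset.sum_le_sum fun i _ => ?_
      simp only [Real.norm_eq_abs, sq_abs]
      exact mul_le_mul_of_nonneg_right (hk i) (by positivity)
  · intro u v
    rw [symplecticForm_eq_dotProduct, symplecticForm_eq_dotProduct, he, he, mulVec_mulVec,
      dotProduct_mulVec, ← vecMul_transpose, vecMul_vecMul, ← Matrix.mul_assoc, hS,
      ← dotProduct_mulVec]

end

/-! ### The half-sum change of variables and Gaussian integrals -/

open MeasureTheory Complex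

section HalfSum

variable {V : Type*} [NormedAddCommGroup V] [InnerProductSpace ℝ V] [FiniteDimensional ℝ V]
  [MeasurableSpace V] [BorelSpace V]

/-- The map is a composite of swaps, a shear and a reflected shear (a, y) ↦ (a, a - y). It turns
integrals over the Wigner variables x ± y/2 into products. -/
theorem measurePreserving_halfSum : MeasurePreserving
    (fun z : V × V => (z.1 + (1 / 2 : ℝ) • z.2, z.1 - (1 / 2 : ℝ) • z.2))
    (volume.prod volume) (volume.prod volume) := by
  have h1 : MeasurePreserving (fun z : V × V => (z.1, z.2 + (1 / 2 : ℝ) • z.1))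
      (volume.prod volume) (volume.prod volume) :=
    (MeasurePreserving.id volume).skew_product (by fun_prop)
      (Filter.Eventually.of_forall fun a => map_add_right_eq_self volume _)
  have h2 : MeasurePreserving (fun z : V × V => (z.1, z.1 - z.2))
      (volume.prod volume) (volume.prod volume) :=
    (MeasurePreserving.id volume).skew_product (by fun_prop)
      (Filter.Eventually.of_forall fun a => Measure.map_sub_left_eq_self volume a)
  have h := h2.comp (Measure.measurePreserving_swap.comp (h1.comp
    (Measure.measurePreserving_swap (μ := (volume : Measure V)) (ν := (volume : Measure V)))))
  convert h using 1
  funext z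
  simp only [Function.comp, Prod.swap, Prod.mk.injEq, true_and]
  module

theorem integrable_halfSum {F G : V → ℂ} (hF : Integrable F) (hG : Integrable G) :
    Integrable (fun z : V × V => F (z.1 + (1 / 2 : ℝ) • z.2) * G (z.1 - (1 / 2 : ℝ) • z.2))
      (volume.prod volume) :=
  measurePreserving_halfSum.integrable_comp_of_integrable (hF.mul_prod hG)

theorem integral_halfSum {F G : V → ℂ} (hF : Integrable F) (hG : Integrable G) :
    ∫ x, ∫ y, F (x + (1 / 2 : ℝ) • y) * G (x - (1 / 2 : ℝ) • y) = (∫ x, F x) * ∫ x, G x := by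
  rw [← integral_prod_mul, ← integral_prod _ (integrable_halfSum hF hG)]
  have h := measurePreserving_halfSum (V := V)
  conv_rhs => rw [← h.map_eq]
  rw [integral_map h.measurable.aemeasurable]
  rw [h.map_eq]
  exact (hF.mul_prod hG).aestronglyMeasurable

theorem memLp_comp_add_smul {f : V → ℂ} (hf : MemLp f 2) (x : V) {r : ℝ} (hr : r ≠ 0) :
    MemLp (fun y => f (x + r • y)) 2 := by
  have hm : AEStronglyMeasurable (fun y => f (x + r • y)) volume := by
    have h1 : Measure.QuasiMeasurePreserving (fun y : V => x + r • y) volume volume :=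
      (measurePreserving_add_left volume x).quasiMeasurePreserving.comp
        ⟨by fun_prop, by
          rw [Measure.map_addHaar_smul volume hr]
          exact Measure.smul_absolutelyContinuous⟩
    exact hf.aestronglyMeasurable.comp_quasiMeasurePreserving h1
  rw [memLp_two_iff_integrable_sq_norm hm]
  have := (memLp_two_iff_integrable_sq_norm hf.aestronglyMeasurable).1 hf
  exact (this.comp_add_left x).comp_smul hr

theorem integrable_halfSum_of_memLp {f g : V → ℂ} (hf : MemLp f 2) (hg : MemLp g 2) (x : V) :
    Integrable fun y =>
      f (x + (1 / 2 : ℝ) • y) * (starRingEnd ℂ) (g (x - (1 / 2 : ℝ) • y)) := by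
  have h1 := memLp_comp_add_smul hf x (r := 1 / 2) (by norm_num)
  have h2 := memLp_comp_add_smul hg x (r := -(1 / 2)) (by norm_num)
  have h3 : MemLp (fun y : V => (starRingEnd ℂ) (g (x - (1 / 2 : ℝ) • y))) 2 volume := by
    convert h2.star using 1
    funext y
    rw [sub_eq_add_neg, ← neg_smul]
    rfl
  exact h1.integrable_mul h3

/-- A Gaussian wave packet integral against a plane wave. -/
theorem integral_gaussian_plane_wave {ħ : ℝ} (hħ : 0 < ħ) (p₀ y : V) :
    ∫ p : V, cexp (-(I * ((inner ℝ p y / ħ : ℝ) : ℂ))) *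
        (Real.exp (-(‖p - p₀‖ ^ 2 / ħ)) : ℂ) =
      ((∫ p : V, Real.exp (-(‖p‖ ^ 2 / ħ)) : ℝ) : ℂ) *
        (cexp (-(I * ((inner ℝ p₀ y / ħ : ℝ) : ℂ))) * (Real.exp (-(‖y‖ ^ 2 / (4 * ħ))) : ℂ)) := by
  have hb : 0 < (((1 / ħ : ℝ) : ℂ)).re := by simp [hħ]
  have hħ' : (ħ : ℂ) ≠ 0 := by exact_mod_cast hħ.ne'
  rw [← integral_add_right_eq_self _ p₀]
  have h1 := GaussianFourier.integral_cexp_neg_mul_sq_norm_add hb (-(I / ħ)) y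
  have h2 := GaussianFourier.integral_cexp_neg_mul_sq_norm_add hb 0 (0 : V)
  have h3 : ((∫ p : V, Real.exp (-(‖p‖ ^ 2 / ħ)) : ℝ) : ℂ) =
      ∫ p : V, cexp (-((1 / ħ : ℝ) : ℂ) * ‖p‖ ^ 2 + 0 * ((inner ℝ (0 : V) p : ℝ) : ℂ)) := by
    rw [← integral_complex_ofReal]
    congr 1
    funext p
    rw [ofReal_exp]
    congr 1
    push_cast
    ring
  rw [h3, h2]
  calc _ = ∫ p : V, cexp (-(I * ((inner ℝ p₀ y / ħ : ℝ) : ℂ))) *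
        cexp (-((1 / ħ : ℝ) : ℂ) * ‖p‖ ^ 2 + -(I / ħ) * ((inner ℝ y p : ℝ) : ℂ)) := by
        congr 1
        funext p
        rw [ofReal_exp, ← Complex.exp_add, ← Complex.exp_add, inner_add_left,
          real_inner_comm p y, add_sub_cancel_right]
        congr 1
        push_cast
        ring
    _ = _ := by
        rw [integral_const_mul, h1]
        have : (-(I / ħ)) ^ 2 * (‖y‖ : ℂ) ^ 2 / (4 * ((1 / ħ : ℝ) : ℂ)) =
            ((-(‖y‖ ^ 2 / (4 * ħ)) : ℝ) : ℂ) := by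
          push_cast
          rw [neg_sq, div_pow, I_sq]
          field_simp
        rw [this, ofReal_exp]
        simp
        ring

theorem integrable_exp_neg_norm_sq {b : ℝ} (hb : 0 < b) (x₀ : V) :
    Integrable fun x : V => Real.exp (-(b * ‖x - x₀‖ ^ 2)) := by
  have h := GaussianFourier.integrable_cexp_neg_mul_sq_norm_add (b := (b : ℂ)) (by simpa) 0 (0 : V)
  have h2 := h.norm.comp_sub_right x₀
  refine h2.congr (Filter.Eventually.of_forall fun x => ?_)
  simp only [Complex.norm_exp]
  congr 1
  rw [zero_mul, add_zero, ← ofReal_pow, ← ofReal_neg, ← ofReal_mul, ofReal_re, neg_mul]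

theorem memLp_exp_neg_norm_sq {b : ℝ} (hb : 0 < b) (x₀ : V) :
    MemLp (fun x : V => Real.exp (-(b * ‖x - x₀‖ ^ 2))) 2 := by
  rw [memLp_two_iff_integrable_sq (by fun_prop)]
  refine (integrable_exp_neg_norm_sq (mul_pos two_pos hb) x₀).congr
    (Filter.Eventually.of_forall fun x => ?_)
  simp only [← Real.exp_nat_mul]
  congr 1
  push_cast
  ring

theorem integral_exp_neg_norm_sq_pos {b : ℝ} (hb : 0 < b) :
    0 < ∫ x : V, Real.exp (-(b * ‖x‖ ^ 2)) := by
  simp_rw [← neg_mul]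
  rw [GaussianFourier.integral_rexp_neg_mul_sq_norm hb]
  positivity

end HalfSum

/-- The phase space point `(x, p)`. -/
def phasePoint {n : ℕ} (x p : ConfigSpace n) : PhaseSpace n :=
  WithLp.toLp 2 (Sum.elim x p)

@[simp] theorem phasePoint_pos {n : ℕ} (x p : ConfigSpace n) : (phasePoint x p).pos = x := rfl

@[simp] theorem phasePoint_mom {n : ℕ} (x p : ConfigSpace n) : (phasePoint x p).mom = p := rfl

/-! ### From the Wigner transform to overlaps with coherent states -/

section Husimi

variable {n : ℕ} {ħ : ℝ} {f : ConfigSpace n → ℂ}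

/-- The integrand of the overlap of `f` with the coherent state centred at `(x₀, p₀)`. -/
noncomputable def coherentIntegrand (ħ : ℝ) (f : ConfigSpace n → ℂ) (x₀ p₀ u : ConfigSpace n) :
    ℂ :=
  f u * ((Real.exp (-(1 / (2 * ħ) * ‖u - x₀‖ ^ 2)) : ℝ) : ℂ) *
    cexp (-(I * ((inner ℝ p₀ u / ħ : ℝ) : ℂ)))

theorem norm_cexp_neg_I_mul_ofReal (r : ℝ) : ‖cexp (-(I * (r : ℂ)))‖ = 1 := by
  rw [← mul_neg, mul_comm, ← ofReal_neg, Complex.norm_exp_ofReal_mul_I]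

theorem integrable_coherentIntegrand (hħ : 0 < ħ) (hf : MemLp f 2) (x₀ p₀ : ConfigSpace n) :
    Integrable (coherentIntegrand ħ f x₀ p₀) := by
  have h1 : Integrable fun u : ConfigSpace n =>
      f u * ((Real.exp (-(1 / (2 * ħ) * ‖u - x₀‖ ^ 2)) : ℝ) : ℂ) :=
    hf.integrable_mul (memLp_exp_neg_norm_sq (by positivity) x₀).ofReal
  refine h1.mono (h1.aestronglyMeasurable.mul (by fun_prop))
    (Filter.Eventually.of_forall fun u => ?_)
  rw [coherentIntegrand, norm_mul _ (cexp _), norm_cexp_neg_I_mul_ofReal, mul_one]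

theorem integrable_wigner_integrand (hħ : 0 < ħ) (hf : MemLp f 2) (x p₀ : ConfigSpace n) :
    Integrable (fun z : ConfigSpace n × ConfigSpace n =>
      cexp (-(I * ((inner ℝ z.1 z.2 / ħ : ℝ) : ℂ))) * f (x + (1 / 2 : ℝ) • z.2) *
        (starRingEnd ℂ) (f (x - (1 / 2 : ℝ) • z.2)) *
        (Real.exp (-(‖z.1 - p₀‖ ^ 2 / ħ)) : ℂ)) (volume.prod volume) := by
  have h1 : Integrable fun p : ConfigSpace n => ((Real.exp (-(‖p - p₀‖ ^ 2 / ħ)) : ℝ) : ℂ) := by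
    have := integrable_exp_neg_norm_sq (V := ConfigSpace n) (one_div_pos.2 hħ) p₀
    simp only [one_div_mul_eq_div] at this
    exact this.ofReal
  have h2 := h1.mul_prod (integrable_halfSum_of_memLp hf hf x)
  have h3 : AEStronglyMeasurable (fun z : ConfigSpace n × ConfigSpace n =>
      cexp (-(I * ((inner ℝ z.1 z.2 / ħ : ℝ) : ℂ)))) (volume.prod volume) := by fun_prop
  refine (h2.mono (h3.mul h2.aestronglyMeasurable)
    (Filter.Eventually.of_forall fun z => ?_)).congr (Filter.Eventually.of_forall fun z => ?_)
  · rw [Pi.mul_apply, norm_mul (cexp _), norm_cexp_neg_I_mul_ofReal, one_mul]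
  · simp only [Pi.mul_apply]
    ring

theorem integrable_wignerMoyal_mul_gaussian (hħ : 0 < ħ) (hf : MemLp f 2) (x p₀ : ConfigSpace n) :
    Integrable fun p => wignerMoyal ħ f f (phasePoint x p) *
      (Real.exp (-(‖p - p₀‖ ^ 2 / ħ)) : ℂ) := by
  have h := (integrable_wigner_integrand hħ hf x p₀).integral_prod_left.const_mul
    (((1 / (2 * Real.pi * ħ)) ^ n : ℝ) : ℂ)
  refine h.congr (Filter.Eventually.of_forall fun p => ?_)
  simp only [wignerMoyal, phasePoint_pos, phasePoint_mom]
  rw [integral_mul_const]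
  ring

/-- By Fubini the p-integral can be done first; the Gaussian in p becomes a Gaussian in y with a
phase at p₀. -/
theorem integral_wignerMoyal_mul_gaussian (hħ : 0 < ħ) (hf : MemLp f 2) (x p₀ : ConfigSpace n) :
    ∫ p, wignerMoyal ħ f f (phasePoint x p) * (Real.exp (-(‖p - p₀‖ ^ 2 / ħ)) : ℂ) =
      (((1 / (2 * Real.pi * ħ)) ^ n * ∫ p : ConfigSpace n, Real.exp (-(‖p‖ ^ 2 / ħ)) : ℝ) : ℂ) *
        ∫ y, f (x + (1 / 2 : ℝ) • y) * (starRingEnd ℂ) (f (x - (1 / 2 : ℝ) • y)) *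
          (cexp (-(I * ((inner ℝ p₀ y / ħ : ℝ) : ℂ))) *
            (Real.exp (-(‖y‖ ^ 2 / (4 * ħ))) : ℂ)) := by
  simp only [wignerMoyal, phasePoint_pos, phasePoint_mom, mul_assoc, ← integral_mul_const]
  rw [integral_const_mul]
  have h := integrable_wigner_integrand hħ hf x p₀
  simp only [mul_assoc] at h
  rw [integral_integral_swap h, ofReal_mul, mul_assoc]
  congr 1
  rw [← integral_const_mul]
  congr 1
  funext y
  have := integral_gaussian_plane_wave hħ p₀ y
  calc _ = ∫ p, (f (x + (1 / 2 : ℝ) • y) * (starRingEnd ℂ) (f (x - (1 / 2 : ℝ) • y))) *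
        (cexp (-(I * ((inner ℝ p y / ħ : ℝ) : ℂ))) * (Real.exp (-(‖p - p₀‖ ^ 2 / ħ)) : ℂ)) := by
        congr 1; funext p; ring
    _ = _ := by rw [integral_const_mul, this]; ring

/-- The parallelogram law splits the product of the two Gaussians at x ± y/2 into one in x - x₀ and
one in y, and the phases combine to p₀·y. The result is the integrand left by the p-smoothing of the
Wigner transform. -/
theorem coherentIntegrand_mul_conj (hħ : 0 < ħ) (x₀ p₀ x y : ConfigSpace n) :
    coherentIntegrand ħ f x₀ p₀ (x + (1 / 2 : ℝ) • y) *
        (starRingEnd ℂ) (coherentIntegrand ħ f x₀ p₀ (x - (1 / 2 : ℝ) • y)) =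
      (Real.exp (-(‖x - x₀‖ ^ 2 / ħ)) : ℂ) *
        (f (x + (1 / 2 : ℝ) • y) * (starRingEnd ℂ) (f (x - (1 / 2 : ℝ) • y)) *
          (cexp (-(I * ((inner ℝ p₀ y / ħ : ℝ) : ℂ))) *
            (Real.exp (-(‖y‖ ^ 2 / (4 * ħ))) : ℂ))) := by
  have hn : ‖x + (1 / 2 : ℝ) • y - x₀‖ ^ 2 + ‖x - (1 / 2 : ℝ) • y - x₀‖ ^ 2 =
      2 * ‖x - x₀‖ ^ 2 + ‖y‖ ^ 2 / 2 := by
    have h := parallelogram_law_with_norm ℝ (x - x₀) ((1 / 2 : ℝ) • y)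
    rw [norm_smul, Real.norm_eq_abs, abs_of_pos (by norm_num : (0 : ℝ) < 1 / 2)] at h
    rw [show x + (1 / 2 : ℝ) • y - x₀ = x - x₀ + (1 / 2 : ℝ) • y by abel,
      show x - (1 / 2 : ℝ) • y - x₀ = x - x₀ - (1 / 2 : ℝ) • y by abel]
    linarith
  have hreal : Real.exp (-(1 / (2 * ħ) * ‖x + (1 / 2 : ℝ) • y - x₀‖ ^ 2)) *
      Real.exp (-(1 / (2 * ħ) * ‖x - (1 / 2 : ℝ) • y - x₀‖ ^ 2)) =
      Real.exp (-(‖x - x₀‖ ^ 2 / ħ)) * Real.exp (-(‖y‖ ^ 2 / (4 * ħ))) := by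
    rw [← Real.exp_add, ← Real.exp_add]
    congr 1
    rw [← neg_add, ← mul_add, hn]
    field_simp
    ring
  have hph : cexp (-(I * ((inner ℝ p₀ (x + (1 / 2 : ℝ) • y) / ħ : ℝ) : ℂ))) *
      cexp (I * ((inner ℝ p₀ (x - (1 / 2 : ℝ) • y) / ħ : ℝ) : ℂ)) =
      cexp (-(I * ((inner ℝ p₀ y / ħ : ℝ) : ℂ))) := by
    rw [← Complex.exp_add]
    congr 1
    simp only [inner_add_right, inner_sub_right, inner_smul_right]
    push_cast
    ring
  rw [← hph]
  have hreal' := congrArg (fun r : ℝ => (r : ℂ)) hreal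
  simp only [ofReal_mul] at hreal'
  simp only [coherentIntegrand, map_mul, ← Complex.exp_conj, map_neg, Complex.conj_I,
    Complex.conj_ofReal, neg_mul, neg_neg]
  linear_combination (f (x + (1 / 2 : ℝ) • y) * (starRingEnd ℂ) (f (x - (1 / 2 : ℝ) • y)) *
    cexp (-(I * ((inner ℝ p₀ (x + (1 / 2 : ℝ) • y) / ħ : ℝ) : ℂ))) *
      cexp (I * ((inner ℝ p₀ (x - (1 / 2 : ℝ) • y) / ħ : ℝ) : ℂ))) * hreal'

/-- A Gaussian upper bound for the Wigner transform gives one for the overlaps with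
coherent states (the Husimi function). -/
theorem norm_integral_coherentIntegrand_sq_le (hħ : 0 < ħ) (hf : MemLp f 2) {C ε : ℝ} (hC : 0 ≤ C)
    (hε : 0 < ε) {q κ : ConfigSpace n → ConfigSpace n → ℝ}
    (hW : ∀ x p, wigner ħ f (phasePoint x p) ≤ C * Real.exp (-(q x p / ħ)))
    (hq : ∀ x p x₀ p₀, κ x₀ p₀ + ε * (‖x - x₀‖ ^ 2 + ‖p - p₀‖ ^ 2) ≤
      q x p + (‖x - x₀‖ ^ 2 + ‖p - p₀‖ ^ 2)) :
    ∃ C' : ℝ, ∀ x₀ p₀, ‖∫ u, coherentIntegrand ħ f x₀ p₀ u‖ ^ 2 ≤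
      C' * Real.exp (-(κ x₀ p₀ / ħ)) := by
  set A : ℝ := (1 / (2 * Real.pi * ħ)) ^ n * ∫ p : ConfigSpace n, Real.exp (-(‖p‖ ^ 2 / ħ)) with hA
  have hApos : 0 < A := by
    have := integral_exp_neg_norm_sq_pos (V := ConfigSpace n) (one_div_pos.2 hħ)
    simp only [one_div_mul_eq_div] at this
    have hpi := Real.pi_pos
    positivity
  -- The slack ε in `hq` leaves the factors exp(-ε‖·‖²/ħ) in x - x₀ and p - p₀; B is the mass of
  -- each.
  set B : ℝ := ∫ p : ConfigSpace n, Real.exp (-(ε / ħ * ‖p‖ ^ 2)) with hB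
  refine ⟨A⁻¹ * (C * B * B), fun x₀ p₀ => ?_⟩
  have hεħ : 0 < ε / ħ := by positivity
  have hF := integrable_coherentIntegrand hħ hf x₀ p₀
  have hFc : Integrable fun u => (starRingEnd ℂ) (coherentIntegrand ħ f x₀ p₀ u) :=
    (Complex.conjCLE : ℂ →L[ℝ] ℂ).integrable_comp hF
  -- This writes |∫F|², with F the coherent integrand, as a double integral over x and y.
  have hprod := integral_halfSum hF hFc
  have hint := (integrable_halfSum hF hFc).integral_prod_left
  simp only [coherentIntegrand_mul_conj hħ, integral_const_mul] at hprod hint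
  rw [integral_conj, Complex.mul_conj, Complex.normSq_eq_norm_sq] at hprod
  have hAmul : ∀ x : ConfigSpace n, (A : ℂ) * ((Real.exp (-(‖x - x₀‖ ^ 2 / ħ)) : ℂ) *
        ∫ y, f (x + (1 / 2 : ℝ) • y) * (starRingEnd ℂ) (f (x - (1 / 2 : ℝ) • y)) *
          (cexp (-(I * ((inner ℝ p₀ y / ħ : ℝ) : ℂ))) *
            (Real.exp (-(‖y‖ ^ 2 / (4 * ħ))) : ℂ))) =
      (Real.exp (-(‖x - x₀‖ ^ 2 / ħ)) : ℂ) * ∫ p, wignerMoyal ħ f f (phasePoint x p) *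
        (Real.exp (-(‖p - p₀‖ ^ 2 / ħ)) : ℂ) := by
    intro x
    rw [integral_wignerMoyal_mul_gaussian hħ hf]
    ring
  have hint2 := hint.const_mul (A : ℂ)
  have hprod2 := congrArg (fun r : ℂ => (A : ℂ) * r) hprod
  simp only [← integral_const_mul (A : ℂ)] at hprod2
  simp only [hAmul] at hint2 hprod2
  have hre := congrArg Complex.re hprod2
  rw [← ofReal_mul, ofReal_re] at hre
  have hre2 := integral_re hint2
  simp only [RCLike.re_to_complex] at hre2
  rw [← hre2] at hre
  -- The Gaussian weights are positive, so the upper bound on the Wigner transform can be integrated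
  -- without any lower bound.
  have hinner : ∀ x, ((Real.exp (-(‖x - x₀‖ ^ 2 / ħ)) : ℂ) *
      ∫ p, wignerMoyal ħ f f (phasePoint x p) * (Real.exp (-(‖p - p₀‖ ^ 2 / ħ)) : ℂ)).re ≤
      C * Real.exp (-(κ x₀ p₀ / ħ)) * B * Real.exp (-(ε / ħ * ‖x - x₀‖ ^ 2)) := by
    intro x
    have hi := integrable_wignerMoyal_mul_gaussian hħ hf x p₀
    have h1 := integral_re hi
    simp only [RCLike.re_to_complex] at h1
    rw [re_ofReal_mul, ← h1, ← integral_const_mul]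
    have hB2 : B = ∫ p : ConfigSpace n, Real.exp (-(ε / ħ * ‖p - p₀‖ ^ 2)) :=
      (integral_sub_right_eq_self (fun p : ConfigSpace n => Real.exp (-(ε / ħ * ‖p‖ ^ 2))) p₀).symm
    rw [hB2, mul_right_comm, ← integral_const_mul]
    refine integral_mono (hi.re.const_mul _)
      ((integrable_exp_neg_norm_sq hεħ p₀).const_mul _) fun p => ?_
    simp only [mul_comm (wignerMoyal _ _ _ _), re_ofReal_mul]
    change _ * (_ * wigner ħ f (phasePoint x p)) ≤ _
    have hexp : Real.exp (-(‖x - x₀‖ ^ 2 / ħ)) * (Real.exp (-(‖p - p₀‖ ^ 2 / ħ)) *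
          Real.exp (-(q x p / ħ))) ≤
        Real.exp (-(κ x₀ p₀ / ħ)) * Real.exp (-(ε / ħ * ‖x - x₀‖ ^ 2)) *
          Real.exp (-(ε / ħ * ‖p - p₀‖ ^ 2)) := by
      rw [← Real.exp_add, ← Real.exp_add, ← Real.exp_add, ← Real.exp_add, Real.exp_le_exp]
      have := div_le_div_of_nonneg_right (hq x p x₀ p₀) hħ.le
      have e1 : (κ x₀ p₀ + ε * (‖x - x₀‖ ^ 2 + ‖p - p₀‖ ^ 2)) / ħ =
        κ x₀ p₀ / ħ + ε / ħ * ‖x - x₀‖ ^ 2 + ε / ħ * ‖p - p₀‖ ^ 2 := by ring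
      have e2 : (q x p + (‖x - x₀‖ ^ 2 + ‖p - p₀‖ ^ 2)) / ħ =
        q x p / ħ + ‖x - x₀‖ ^ 2 / ħ + ‖p - p₀‖ ^ 2 / ħ := by ring
      linarith
    calc _ ≤ Real.exp (-(‖x - x₀‖ ^ 2 / ħ)) * (Real.exp (-(‖p - p₀‖ ^ 2 / ħ)) *
          (C * Real.exp (-(q x p / ħ)))) := by gcongr; exact hW x p
      _ = C * (Real.exp (-(‖x - x₀‖ ^ 2 / ħ)) * (Real.exp (-(‖p - p₀‖ ^ 2 / ħ)) *
          Real.exp (-(q x p / ħ)))) := by ring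
      _ ≤ C * _ := mul_le_mul_of_nonneg_left hexp hC
      _ = _ := by ring
  have hfin : A * ‖∫ u, coherentIntegrand ħ f x₀ p₀ u‖ ^ 2 ≤
      C * Real.exp (-(κ x₀ p₀ / ħ)) * B * B := by
    rw [← hre]
    calc _ ≤ ∫ x : ConfigSpace n, C * Real.exp (-(κ x₀ p₀ / ħ)) * B *
          Real.exp (-(ε / ħ * ‖x - x₀‖ ^ 2)) :=
          integral_mono hint2.re ((integrable_exp_neg_norm_sq hεħ x₀).const_mul _) hinner
      _ = _ := by
          rw [integral_const_mul, integral_sub_right_eq_self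
            (fun p : ConfigSpace n => Real.exp (-(ε / ħ * ‖p‖ ^ 2))) x₀]
  calc _ = A⁻¹ * (A * ‖∫ u, coherentIntegrand ħ f x₀ p₀ u‖ ^ 2) := by
        rw [inv_mul_cancel_left₀ hApos.ne']
    _ ≤ A⁻¹ * (C * Real.exp (-(κ x₀ p₀ / ħ)) * B * B) := by gcongr
    _ = _ := by ring

end Husimi

/-! ### The Fourier-Laplace transform of a Gaussian-damped function -/

section Bargmann

variable {n : ℕ} {ħ : ℝ} {f : ConfigSpace n → ℂ}

/-- The bilinear pairing `w · u` of `w ∈ ℂⁿ` with `u ∈ ℝⁿ`. -/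
def complexPairing (w : Fin n → ℂ) (u : ConfigSpace n) : ℂ := ∑ j, w j * (u j : ℂ)

theorem complexPairing_add_smul (w v : Fin n → ℂ) (t : ℂ) (u : ConfigSpace n) :
    complexPairing (w + t • v) u = complexPairing w u + t * complexPairing v u := by
  simp [complexPairing, add_mul, Finset.sum_add_distrib, Finset.mul_sum, mul_assoc]

theorem norm_complexPairing_le (w : Fin n → ℂ) (u : ConfigSpace n) :
    ‖complexPairing w u‖ ≤ (∑ j, ‖w j‖) * ‖u‖ := by
  rw [complexPairing, Finset.sum_mul]
  refine (norm_sum_le _ _).trans (Finset.sum_le_sum fun j _ => ?_)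
  rw [norm_mul, Complex.norm_real]
  exact mul_le_mul_of_nonneg_left (PiLp.norm_apply_le u j) (norm_nonneg _)

theorem continuous_complexPairing (w : Fin n → ℂ) : Continuous (complexPairing w) := by
  unfold complexPairing
  fun_prop

/-- The Fourier-Laplace transform of `f` times a Gaussian. -/
noncomputable def bargmannIntegrand (ħ : ℝ) (f : ConfigSpace n → ℂ) (w : Fin n → ℂ)
    (u : ConfigSpace n) : ℂ :=
  f u * ((Real.exp (-(1 / (2 * ħ) * ‖u‖ ^ 2)) : ℝ) : ℂ) * cexp (complexPairing w u / ħ)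

/-- Half of the Gaussian stays with f as a pairing in L²; the other half absorbs the exponential, by
completing the square. -/
theorem integrable_mul_exp_norm (hħ : 0 < ħ) (hf : MemLp f 2) (a : ℝ) :
    Integrable fun u =>
      ‖f u‖ * Real.exp (-(1 / (2 * ħ) * ‖u‖ ^ 2)) * Real.exp (a * ‖u‖) := by
  have h1 : Integrable fun u => ‖f u‖ * Real.exp (-(1 / (4 * ħ) * ‖u - 0‖ ^ 2)) :=
    hf.norm.integrable_mul (memLp_exp_neg_norm_sq (V := ConfigSpace n) (by positivity) 0)
  refine (h1.const_mul (Real.exp (a ^ 2 * ħ))).mono ?_ (Filter.Eventually.of_forall fun u => ?_)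
  · exact (hf.aestronglyMeasurable.norm.mul (by fun_prop)).mul (by fun_prop)
  · rw [Real.norm_of_nonneg (by positivity), Real.norm_of_nonneg (by positivity), mul_assoc,
      mul_left_comm (Real.exp (a ^ 2 * ħ)), sub_zero, ← Real.exp_add, ← Real.exp_add]
    refine mul_le_mul_of_nonneg_left (Real.exp_le_exp.2 ?_) (norm_nonneg _)
    have : 0 ≤ (‖u‖ / (2 * ħ) - a) ^ 2 * ħ := by positivity
    have e : (‖u‖ / (2 * ħ) - a) ^ 2 * ħ = 1 / (4 * ħ) * ‖u‖ ^ 2 - a * ‖u‖ + a ^ 2 * ħ := by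
      field_simp
      ring
    have e2 : 1 / (2 * ħ) * ‖u‖ ^ 2 = 1 / (4 * ħ) * ‖u‖ ^ 2 + 1 / (4 * ħ) * ‖u‖ ^ 2 := by
      field_simp
      ring
    linarith

theorem norm_cexp_complexPairing_le (hħ : 0 < ħ) (w : Fin n → ℂ) (u : ConfigSpace n) :
    ‖cexp (complexPairing w u / ħ)‖ ≤ Real.exp ((∑ j, ‖w j‖) / ħ * ‖u‖) := by
  refine (Complex.norm_exp_le_exp_norm _).trans (Real.exp_le_exp.2 ?_)
  rw [norm_div, Complex.norm_of_nonneg hħ.le, div_mul_eq_mul_div]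
  exact div_le_div_of_nonneg_right (norm_complexPairing_le w u) hħ.le

theorem aestronglyMeasurable_bargmannIntegrand (hf : AEStronglyMeasurable f volume)
    (w : Fin n → ℂ) : AEStronglyMeasurable (bargmannIntegrand ħ f w) volume := by
  have := continuous_complexPairing w
  exact (hf.mul (by fun_prop)).mul (by fun_prop)

theorem integrable_bargmannIntegrand (hħ : 0 < ħ) (hf : MemLp f 2) (w : Fin n → ℂ) :
    Integrable (bargmannIntegrand ħ f w) := by
  refine (integrable_mul_exp_norm hħ hf ((∑ j, ‖w j‖) / ħ)).mono'
    (aestronglyMeasurable_bargmannIntegrand hf.aestronglyMeasurable w)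
    (Filter.Eventually.of_forall fun u => ?_)
  rw [bargmannIntegrand, norm_mul, norm_mul, Complex.norm_real, Real.norm_of_nonneg (by positivity)]
  gcongr
  exact norm_cexp_complexPairing_le hħ w u

/-- Differentiation under the integral sign. Holomorphy along single complex lines is all that
Liouville's theorem will need. -/
theorem differentiable_integral_bargmannIntegrand (hħ : 0 < ħ) (hf : MemLp f 2)
    (w v : Fin n → ℂ) :
    Differentiable ℂ fun t : ℂ => ∫ u, bargmannIntegrand ħ f (w + t • v) u := by
  intro t₀
  set b := ∑ j, ‖v j‖ with hb
  set a := ((∑ j, ‖w j‖) + (‖t₀‖ + 1) * b) / ħ with ha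
  have hbnn : 0 ≤ b := Finset.sum_nonneg fun _ _ => norm_nonneg _
  -- The rate a serves all t within distance 1 of t₀; the extra 1 pays for the factor ‖u‖ ≤ exp ‖u‖
  -- produced by the derivative.
  have hbd := (integrable_mul_exp_norm hħ hf (a + 1)).const_mul (b / ħ)
  have hv := continuous_complexPairing v
  refine ((hasDerivAt_integral_of_dominated_loc_of_deriv_le (𝕜 := ℂ)
    (F' := fun t u => bargmannIntegrand ħ f (w + t • v) u * (complexPairing v u / ħ))
    (Metric.ball_mem_nhds t₀ one_pos)
    (Filter.Eventually.of_forall fun t =>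
      aestronglyMeasurable_bargmannIntegrand hf.aestronglyMeasurable _)
    (integrable_bargmannIntegrand hħ hf _)
    ((aestronglyMeasurable_bargmannIntegrand hf.aestronglyMeasurable _).mul (by fun_prop))
    (Filter.Eventually.of_forall fun u t ht => ?_) hbd
    (Filter.Eventually.of_forall fun u t ht => ?_)).2).differentiableAt
  · have ht' : ‖t‖ ≤ ‖t₀‖ + 1 := by
      have h1 := norm_le_norm_add_norm_sub t₀ t
      have h2 : ‖t₀ - t‖ < 1 := by rw [← dist_eq_norm, dist_comm]; exact ht
      linarith
    have hsum : (∑ j, ‖(w + t • v) j‖) / ħ ≤ a := by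
      rw [ha]
      gcongr
      calc ∑ j, ‖(w + t • v) j‖ ≤ ∑ j, (‖w j‖ + ‖t‖ * ‖v j‖) :=
            Finset.sum_le_sum fun j _ => (norm_add_le _ _).trans (by simp)
        _ = (∑ j, ‖w j‖) + ‖t‖ * b := by rw [Finset.sum_add_distrib, ← Finset.mul_sum]
        _ ≤ _ := by gcongr
    have h1 : ‖cexp (complexPairing (w + t • v) u / ħ)‖ ≤ Real.exp (a * ‖u‖) :=
      (norm_cexp_complexPairing_le hħ _ u).trans (by gcongr)
    have h2 : ‖complexPairing v u / ħ‖ ≤ b / ħ * Real.exp ‖u‖ := by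
      rw [norm_div, Complex.norm_of_nonneg hħ.le, div_mul_eq_mul_div]
      refine div_le_div_of_nonneg_right ((norm_complexPairing_le v u).trans ?_) hħ.le
      have := Real.add_one_le_exp ‖u‖
      exact mul_le_mul_of_nonneg_left (by linarith) hbnn
    rw [bargmannIntegrand, norm_mul, norm_mul, norm_mul, Complex.norm_real,
      Real.norm_of_nonneg (Real.exp_nonneg _)]
    calc _ ≤ ‖f u‖ * Real.exp (-(1 / (2 * ħ) * ‖u‖ ^ 2)) * Real.exp (a * ‖u‖) *
          (b / ħ * Real.exp ‖u‖) := by gcongr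
      _ = _ := by rw [add_mul, one_mul, Real.exp_add]; ring
  · simp only [bargmannIntegrand, complexPairing_add_smul]
    have hd : HasDerivAt (fun t : ℂ => (complexPairing w u + t * complexPairing v u) / ħ)
        (complexPairing v u / ħ) t := by
      simpa using (((hasDerivAt_id t).mul_const (complexPairing v u)).const_add
        (complexPairing w u)).div_const (ħ : ℂ)
    rw [mul_assoc]
    exact hd.cexp.const_mul (f u * ((Real.exp (-(1 / (2 * ħ) * ‖u‖ ^ 2)) : ℝ) : ℂ))

/-- The overlap with a coherent state in terms of the Fourier-Laplace transform. -/
theorem norm_integral_bargmannIntegrand_sq (hħ : 0 < ħ) (w : Fin n → ℂ) :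
    ‖cexp (-(∑ j, w j ^ 2) / (4 * ħ)) * ∫ u, bargmannIntegrand ħ f w u‖ ^ 2 =
      Real.exp ((∑ j, ‖w j‖ ^ 2) / (2 * ħ)) *
        ‖∫ u, coherentIntegrand ħ f (WithLp.toLp 2 fun j => (w j).re)
          (WithLp.toLp 2 fun j => -(w j).im) u‖ ^ 2 := by
  set x₀ : ConfigSpace n := WithLp.toLp 2 fun j => (w j).re with hx
  set p₀ : ConfigSpace n := WithLp.toLp 2 fun j => -(w j).im with hp
  have hħ' : (ħ : ℂ) ≠ 0 := by exact_mod_cast hħ.ne'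
  have h1 : ∀ u, coherentIntegrand ħ f x₀ p₀ u =
      (Real.exp (-(1 / (2 * ħ) * ‖x₀‖ ^ 2)) : ℂ) * bargmannIntegrand ħ f w u := by
    intro u
    have hw : complexPairing w u = (inner ℝ u x₀ : ℝ) - I * (inner ℝ p₀ u : ℝ) := by
      simp only [complexPairing, PiLp.inner_apply, hx, hp, ofReal_sum, Finset.mul_sum]
      rw [← Finset.sum_sub_distrib]
      refine Finset.sum_congr rfl fun j _ => ?_
      simp
      linear_combination (-(u j : ℂ)) * re_add_im (w j)
    rw [coherentIntegrand, bargmannIntegrand, hw]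
    simp only [ofReal_exp]
    rw [norm_sub_sq_real, mul_assoc, ← Complex.exp_add, mul_left_comm, mul_assoc, ← Complex.exp_add,
      ← Complex.exp_add]
    congr 2
    push_cast
    field_simp
    ring
  simp only [h1]
  rw [integral_const_mul, norm_mul, norm_mul, mul_pow, mul_pow, Complex.norm_real,
    Real.norm_of_nonneg (Real.exp_nonneg _), ← mul_assoc, Complex.norm_exp, ← Real.exp_nat_mul,
    ← Real.exp_nat_mul, ← Real.exp_add]
  congr 2
  -- The holomorphic prefactor has squared modulus exp(-(|Re w|² - |Im w|²)/2ħ). With the factor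
  -- exp(|Re w|²/ħ) from `h1`, it gives the radial weight exp(|w|²/2ħ), which singles out no
  -- direction.
  have hre : (-(∑ j, w j ^ 2) / (4 * ħ) : ℂ).re =
      -(∑ j, ((w j).re ^ 2 - (w j).im ^ 2)) / (4 * ħ) := by
    rw [show (4 * ħ : ℂ) = ((4 * ħ : ℝ) : ℂ) by push_cast; rfl, Complex.div_ofReal_re, neg_re,
      re_sum]
    simp [pow_two]
  have hnx : ‖x₀‖ ^ 2 = ∑ j, (w j).re ^ 2 := by
    rw [EuclideanSpace.norm_sq_eq]
    simp [hx]
  have hnw : ∑ j, ‖w j‖ ^ 2 = ∑ j, (w j).re ^ 2 + ∑ j, (w j).im ^ 2 := by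
    rw [← Finset.sum_add_distrib]
    refine Finset.sum_congr rfl fun j _ => ?_
    rw [Complex.sq_norm, normSq_apply]
    ring
  rw [hre, hnx, hnw, Finset.sum_sub_distrib]
  push_cast
  field_simp
  ring

end Bargmann

/-! ### Injectivity of the Fourier transform on integrable functions -/

section FourierInjective

open scoped FourierTransform

/-- A test function is the Fourier transform of a Schwartz function; moving that transform onto g
makes the pairing vanish. -/
theorem ae_eq_zero_of_fourier_eq_zero {V : Type*} [NormedAddCommGroup V] [InnerProductSpace ℝ V]
    [FiniteDimensional ℝ V] [MeasurableSpace V] [BorelSpace V] {g : V → ℂ} (hg : Integrable g)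
    (h : ∀ ξ, 𝓕 g ξ = 0) : ∀ᵐ x, g x = 0 := by
  refine ae_eq_zero_of_integral_contDiff_smul_eq_zero hg.locallyIntegrable fun φ hφ hφc => ?_
  have hφ' : ContDiff ℝ ∞ (fun x => (φ x : ℂ)) := Complex.ofRealCLM.contDiff.comp hφ
  have hφc' : HasCompactSupport (fun x => (φ x : ℂ)) := hφc.comp_left Complex.ofReal_zero
  set Φ : SchwartzMap V ℂ := hφc'.toSchwartzMap hφ' with hΦ
  have hΦF : 𝓕 (𝓕⁻ Φ) = Φ := FourierTransform.fourier_fourierInv_eq Φ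
  have h1 := VectorFourier.integral_fourierIntegral_smul_eq_flip (L := innerₗ V)
    (μ := volume) (ν := volume) Real.continuous_fourierChar continuous_inner
    ((𝓕⁻ Φ : SchwartzMap V ℂ).integrable) hg
  have h2 : ∀ x, VectorFourier.fourierIntegral Real.fourierChar volume (innerₗ V).flip g x = 0 := by
    intro x
    rw [← h x, flip_innerₗ]
    rfl
  have h3 : ∀ x, VectorFourier.fourierIntegral Real.fourierChar volume (innerₗ V)
      (𝓕⁻ Φ : SchwartzMap V ℂ) x = φ x := by
    intro x
    have := congrArg (fun F : SchwartzMap V ℂ => F x) hΦF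
    simp only [SchwartzMap.fourier_coe] at this
    exact this
  simp only [h2, h3, smul_zero, integral_zero] at h1
  simpa only [Complex.real_smul, smul_eq_mul] using h1

end FourierInjective

/-! ### Hardy's principle in one complex direction -/

section Hardy

variable {n : ℕ} {ħ : ℝ} {f : ConfigSpace n → ℂ}

open scoped FourierTransform in
-- At w = -2πiħξ the integral is the Fourier transform at ξ of f times a nowhere vanishing Gaussian.
theorem ae_eq_zero_of_integral_bargmannIntegrand_eq_zero (hħ : 0 < ħ) (hf : MemLp f 2)
    (h : ∀ w, ∫ u, bargmannIntegrand ħ f w u = 0) : ∀ᵐ u, f u = 0 := by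
  have hg : Integrable fun u : ConfigSpace n =>
      f u * ((Real.exp (-(1 / (2 * ħ) * ‖u‖ ^ 2)) : ℝ) : ℂ) := by
    refine (integrable_bargmannIntegrand hħ hf 0).congr (Filter.Eventually.of_forall fun u => ?_)
    simp [bargmannIntegrand, complexPairing]
  have h0 := ae_eq_zero_of_fourier_eq_zero hg fun ξ => by
    rw [Real.fourier_eq', ← h fun j => -(2 * Real.pi * ħ * ξ j : ℂ) * I]
    refine integral_congr_ae (Filter.Eventually.of_forall fun u => ?_)
    simp only [bargmannIntegrand, smul_eq_mul]
    rw [mul_comm]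
    congr 2
    have hħ' : (ħ : ℂ) ≠ 0 := by exact_mod_cast hħ.ne'
    rw [eq_div_iff hħ', complexPairing, PiLp.inner_apply]
    push_cast
    simp only [Finset.mul_sum, Finset.sum_mul]
    refine Finset.sum_congr rfl fun j _ => ?_
    simp
    ring
  filter_upwards [h0] with u hu
  exact (mul_eq_zero.1 hu).resolve_right (by exact_mod_cast (Real.exp_pos _).ne')

/-- Pythagoras: moving along the unit vector v̄ changes only the component of w along v̄, which is ∑
vⱼwⱼ. -/
theorem sum_norm_sq_add_smul_conj {v : Fin n → ℂ} (hv : ∑ j, ‖v j‖ ^ 2 = 1) (w : Fin n → ℂ)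
    (t : ℂ) : ∑ j, ‖(w + t • star v) j‖ ^ 2 =
      ∑ j, ‖w j‖ ^ 2 - ‖∑ j, v j * w j‖ ^ 2 + ‖∑ j, v j * w j + t‖ ^ 2 := by
  have h1 : ∀ j, ‖(w + t • star v) j‖ ^ 2 =
      ‖w j‖ ^ 2 + ‖t‖ ^ 2 * ‖v j‖ ^ 2 + 2 * ((v j * w j) * (starRingEnd ℂ) t).re := by
    intro j
    rw [Pi.add_apply, Complex.sq_norm, normSq_add, ← Complex.sq_norm, ← Complex.sq_norm]
    simp only [Pi.smul_apply, Pi.star_apply, smul_eq_mul, norm_mul, RCLike.star_def, map_mul,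
      Complex.conj_conj, RCLike.norm_conj]
    rw [mul_pow]
    congr 3
    ring
  simp only [h1, Finset.sum_add_distrib, ← Finset.mul_sum, hv, ← re_sum, ← Finset.sum_mul]
  rw [Complex.sq_norm (_ + t), normSq_add, ← Complex.sq_norm, ← Complex.sq_norm]
  ring

/-- If the Husimi function of `f` decays in one complex direction faster than that of the
coherent states, then `f` vanishes. -/
theorem ae_eq_zero_of_coherentIntegrand_bound (hħ : 0 < ħ) (hf : MemLp f 2) {v : Fin n → ℂ}
    (hv : ∑ j, ‖v j‖ ^ 2 = 1) {κ C : ℝ} (hκ : 1 / 2 < κ)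
    (hb : ∀ w : Fin n → ℂ, ‖∫ u, coherentIntegrand ħ f (WithLp.toLp 2 fun j => (w j).re)
      (WithLp.toLp 2 fun j => -(w j).im) u‖ ^ 2 ≤
        C * Real.exp (-(κ * ‖∑ j, v j * w j‖ ^ 2 / ħ))) : ∀ᵐ u, f u = 0 := by
  refine ae_eq_zero_of_integral_bargmannIntegrand_eq_zero hħ hf fun w => ?_
  have hvv : ∑ j, v j * star v j = 1 := by
    have h : ∀ j, v j * star v j = ((‖v j‖ ^ 2 : ℝ) : ℂ) := fun j => by
      rw [Pi.star_apply, RCLike.star_def, Complex.mul_conj, Complex.normSq_eq_norm_sq]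
    simp only [h, ← ofReal_sum, hv, ofReal_one]
  set c := ∑ j, v j * w j with hc
  -- E is entire on the line w + t v̄. Its squared modulus grows at most like exp(|c+t|²/2ħ) times
  -- the assumed decay exp(-κ|c+t|²/ħ); this is where the threshold 1/2 for κ comes from. Liouville
  -- then gives E = 0, used at t = 0.
  let E : ℂ → ℂ := fun t => cexp (-(∑ j, (w + t • star v) j ^ 2) / (4 * ħ)) *
    ∫ u, bargmannIntegrand ħ f (w + t • star v) u
  have hE : Differentiable ℂ E := by
    refine Differentiable.mul ?_ (differentiable_integral_bargmannIntegrand hħ hf w (star v))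
    simp only [Pi.add_apply, Pi.smul_apply, smul_eq_mul]
    fun_prop
  set K := C * Real.exp ((∑ j, ‖w j‖ ^ 2 - ‖c‖ ^ 2) / (2 * ħ)) with hK
  have hbound : ∀ t, ‖E t‖ ^ 2 ≤ K * Real.exp (-((κ - 1 / 2) / ħ * ‖c + t‖ ^ 2)) := by
    intro t
    have hct : ∑ j, v j * (w + t • star v) j = c + t := by
      simp only [Pi.add_apply, Pi.smul_apply, smul_eq_mul, mul_add, Finset.sum_add_distrib,
        mul_left_comm _ t, ← Finset.mul_sum, hvv, mul_one, hc]
    have h1 := hb (w + t • star v)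
    rw [hct] at h1
    calc ‖E t‖ ^ 2 = _ := norm_integral_bargmannIntegrand_sq hħ _
      _ ≤ _ := mul_le_mul_of_nonneg_left h1 (Real.exp_nonneg _)
      _ = _ := by
        rw [sum_norm_sq_add_smul_conj hv, hK, mul_left_comm, mul_assoc, ← Real.exp_add,
          ← Real.exp_add]
        congr 2
        field_simp
        ring
  have hlim : Filter.Tendsto E (Filter.cocompact ℂ) (nhds 0) := by
    have hα : 0 < (κ - 1 / 2) / ħ := div_pos (by linarith) hħ
    have h1 : Filter.Tendsto (fun t : ℂ => ‖c + t‖) (Filter.cocompact ℂ) Filter.atTop :=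
      (tendsto_norm_cocompact_atTop (E := ℂ)).comp
        (Homeomorph.addLeft c).isClosedEmbedding.tendsto_cocompact
    have h2 : Filter.Tendsto (fun t : ℂ => K * Real.exp (-((κ - 1 / 2) / ħ * ‖c + t‖ ^ 2)))
        (Filter.cocompact ℂ) (nhds (K * 0)) :=
      (Real.tendsto_exp_neg_atTop_nhds_zero.comp
        (((Filter.tendsto_pow_atTop two_ne_zero).comp h1).const_mul_atTop hα)).const_mul K
    rw [mul_zero] at h2
    have h3 := squeeze_zero (fun t => sq_nonneg ‖E t‖) hbound h2
    have h4 := h3.sqrt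
    simp only [Real.sqrt_sq (norm_nonneg _), Real.sqrt_zero] at h4
    exact tendsto_zero_iff_norm_tendsto_zero.2 h4
  have h0 := hE.apply_eq_of_tendsto_cocompact 0 hlim
  simp only [E, zero_smul, add_zero] at h0
  exact (mul_eq_zero.1 h0).resolve_left (Complex.exp_ne_zero _)

/-- **Hardy's uncertainty principle** for the Wigner transform in one complex direction. -/
theorem ae_eq_zero_of_wigner_le (hħ : 0 < ħ) (hf : MemLp f 2) {v : Fin n → ℂ}
    (hv : ∑ j, ‖v j‖ ^ 2 = 1) {l C : ℝ} (hl : 1 < l) (hC : 0 ≤ C)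
    (hW : ∀ x p, wigner ħ f (phasePoint x p) ≤
      C * Real.exp (-(l * ‖∑ j, v j * ((x j : ℂ) - I * p j)‖ ^ 2 / ħ))) : ∀ᵐ u, f u = 0 := by
  -- The fraction is the best κ in κ(a+b)² ≤ la² + (1-ε)b². For small ε it is near l/(l+1), above
  -- 1/2 because l > 1. This ε makes 2l(1-ε) = l + 1, so that κ > 1/2 reduces to 1 - ε < 1.
  obtain ⟨ε, hε, hε1, hκ⟩ : ∃ ε : ℝ, 0 < ε ∧ ε < 1 ∧
      1 / 2 < l * (1 - ε) / (l + (1 - ε)) := by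
    refine ⟨(l - 1) / (2 * l), by apply div_pos <;> linarith, ?_, ?_⟩
    · rw [div_lt_one (by linarith)]
      linarith
    · have h : 1 - (l - 1) / (2 * l) = (l + 1) / (2 * l) := by field_simp; ring
      have h2 : 0 < (l + 1) / (2 * l) := by apply div_pos <;> linarith
      rw [h, div_lt_div_iff₀ two_pos (by linarith)]
      have h3 : l * ((l + 1) / (2 * l)) = (l + 1) / 2 := by field_simp
      have h4 : (l + 1) / (2 * l) < 1 := by rw [div_lt_one (by linarith)]; linarith
      rw [h3]
      linarith
  set κ := l * (1 - ε) / (l + (1 - ε)) with hκd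
  let ζ : ConfigSpace n → ConfigSpace n → ℂ := fun x p => ∑ j, v j * ((x j : ℂ) - I * p j)
  have hcs : ∀ x p, ‖ζ x p‖ ^ 2 ≤ ‖x‖ ^ 2 + ‖p‖ ^ 2 := by
    intro x p
    have h1 : ‖ζ x p‖ ≤ ∑ j, ‖v j‖ * ‖(x j : ℂ) - I * p j‖ :=
      (norm_sum_le _ _).trans (by simp only [norm_mul, le_refl])
    have h2 := Finset.sum_mul_sq_le_sq_mul_sq Finset.univ (fun j => ‖v j‖)
      fun j => ‖(x j : ℂ) - I * p j‖
    have h3 : ∑ j, ‖(x j : ℂ) - I * p j‖ ^ 2 = ‖x‖ ^ 2 + ‖p‖ ^ 2 := by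
      rw [EuclideanSpace.norm_sq_eq, EuclideanSpace.norm_sq_eq, ← Finset.sum_add_distrib]
      refine Finset.sum_congr rfl fun j _ => ?_
      rw [Complex.sq_norm, normSq_apply]
      simp
      ring
    rw [hv, h3, one_mul] at h2
    exact (pow_le_pow_left₀ (norm_nonneg _) h1 2).trans h2
  have hζ : ∀ x p x₀ p₀, ζ x p = ζ x₀ p₀ + ζ (x - x₀) (p - p₀) := by
    intro x p x₀ p₀
    simp only [ζ, ← Finset.sum_add_distrib]
    refine Finset.sum_congr rfl fun j _ => ?_
    simp
    ring
  obtain ⟨C', hC'⟩ := norm_integral_coherentIntegrand_sq_le hħ hf hC hε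
    (q := fun x p => l * ‖ζ x p‖ ^ 2) (κ := fun x p => κ * ‖ζ x p‖ ^ 2) hW (by
      intro x p x₀ p₀
      have h1 := hcs (x - x₀) (p - p₀)
      have h2 : ‖ζ x₀ p₀‖ ≤ ‖ζ x p‖ + ‖ζ (x - x₀) (p - p₀)‖ := by
        rw [hζ x p x₀ p₀]
        have := norm_sub_le (ζ x₀ p₀ + ζ (x - x₀) (p - p₀)) (ζ (x - x₀) (p - p₀))
        rwa [add_sub_cancel_right] at this
      set a := ‖ζ x p‖
      set b := ‖ζ (x - x₀) (p - p₀)‖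
      have h3 : ‖ζ x₀ p₀‖ ^ 2 ≤ (a + b) ^ 2 := pow_le_pow_left₀ (norm_nonneg _) h2 2
      have hpos : 0 < l + (1 - ε) := by linarith
      have h4 : κ * (a + b) ^ 2 ≤ l * a ^ 2 + (1 - ε) * b ^ 2 := by
        rw [hκd, div_mul_eq_mul_div, div_le_iff₀ hpos]
        -- The two sides differ by exactly this square.
        nlinarith [sq_nonneg (l * a - (1 - ε) * b)]
      have h5 : κ * ‖ζ x₀ p₀‖ ^ 2 ≤ κ * (a + b) ^ 2 :=
        mul_le_mul_of_nonneg_left h3 (by linarith)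
      have h6 := mul_le_mul_of_nonneg_left h1 (by linarith : 0 ≤ 1 - ε)
      change κ * ‖ζ x₀ p₀‖ ^ 2 + _ ≤ l * a ^ 2 + _
      linarith)
  refine ae_eq_zero_of_coherentIntegrand_bound hħ hf hv hκ (C := C') fun w => ?_
  refine (hC' _ _).trans_eq ?_
  have hw : ζ (WithLp.toLp 2 fun j => (w j).re) (WithLp.toLp 2 fun j => -(w j).im) =
      ∑ j, v j * w j := by
    refine Finset.sum_congr rfl fun j _ => ?_
    simp only [ofReal_neg]
    linear_combination v j * re_add_im (w j)
  simp only [hw]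

end Hardy

/-! ### Covariance of the Wigner transform under lower triangular symplectic maps -/

section Covariance

variable {n : ℕ} {ħ : ℝ} {f : ConfigSpace n → ℂ}

/-- The action on wave functions of the metaplectic operators of the lower triangular
symplectic maps `(x, p) ↦ (ℓ x, ℓ⁻¹ (p - Y x))`, up to normalization. -/
noncomputable def lowerMetaplectic (ħ : ℝ) (ℓ : ConfigSpace n ≃L[ℝ] ConfigSpace n)
    (Y : ConfigSpace n →L[ℝ] ConfigSpace n) (f : ConfigSpace n → ℂ) (u : ConfigSpace n) : ℂ :=
  cexp (-(I * ((-(inner ℝ (Y u) u / (2 * ħ)) : ℝ) : ℂ))) * f (ℓ u)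

theorem map_continuousLinearEquiv_volume (ℓ : ConfigSpace n ≃L[ℝ] ConfigSpace n) :
    Measure.map ℓ volume =
      ENNReal.ofReal |(LinearMap.det (ℓ : ConfigSpace n →ₗ[ℝ] ConfigSpace n))⁻¹| • volume :=
  Measure.map_linearMap_addHaar_eq_smul_addHaar volume ℓ.toLinearEquiv.isUnit_det'.ne_zero

theorem memLp_comp_continuousLinearEquiv (ℓ : ConfigSpace n ≃L[ℝ] ConfigSpace n)
    (hf : MemLp f 2) : MemLp (fun u => f (ℓ u)) 2 := by
  refine MemLp.comp_of_map (g := f) ?_ ℓ.continuous.aemeasurable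
  rw [map_continuousLinearEquiv_volume]
  exact hf.smul_measure ENNReal.ofReal_ne_top

theorem memLp_lowerMetaplectic (ℓ : ConfigSpace n ≃L[ℝ] ConfigSpace n)
    (Y : ConfigSpace n →L[ℝ] ConfigSpace n) (hf : MemLp f 2) :
    MemLp (lowerMetaplectic ħ ℓ Y f) 2 := by
  have h := memLp_comp_continuousLinearEquiv ℓ hf
  have hm : AEStronglyMeasurable (fun u : ConfigSpace n =>
      cexp (-(I * ((-(inner ℝ (Y u) u / (2 * ħ)) : ℝ) : ℂ)))) volume := by fun_prop
  refine h.of_le (hm.mul h.aestronglyMeasurable) (Filter.Eventually.of_forall fun u => ?_)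
  rw [lowerMetaplectic, norm_mul, norm_cexp_neg_I_mul_ofReal, one_mul]

theorem ae_eq_zero_of_lowerMetaplectic (ℓ : ConfigSpace n ≃L[ℝ] ConfigSpace n)
    (Y : ConfigSpace n →L[ℝ] ConfigSpace n) (h : ∀ᵐ u, lowerMetaplectic ħ ℓ Y f u = 0) :
    ∀ᵐ u, f u = 0 := by
  have hq : Measure.QuasiMeasurePreserving ℓ.symm (volume : Measure (ConfigSpace n)) volume :=
    ⟨ℓ.symm.continuous.measurable, by
      rw [map_continuousLinearEquiv_volume]; exact Measure.smul_absolutelyContinuous⟩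
  filter_upwards [hq.ae h] with u hu
  simpa [lowerMetaplectic, Complex.exp_ne_zero] using hu

/-- The quadratic phases at x ± y/2 differ by Yx·y/ħ, which shifts p to p - Yx; substituting ℓy for
y moves ℓ⁻¹ onto the momentum and produces the determinant. -/
theorem wigner_lowerMetaplectic (ℓ : ConfigSpace n ≃L[ℝ] ConfigSpace n)
    (Y : ConfigSpace n →L[ℝ] ConfigSpace n)
    (hℓ : ∀ a b, inner ℝ (ℓ a) b = inner ℝ a (ℓ b)) (hY : ∀ a b, inner ℝ (Y a) b = inner ℝ a (Y b))
    (x p : ConfigSpace n) :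
    wigner ħ (lowerMetaplectic ħ ℓ Y f) (phasePoint x p) =
      |(LinearMap.det (ℓ : ConfigSpace n →ₗ[ℝ] ConfigSpace n))⁻¹| *
        wigner ħ f (phasePoint (ℓ x) (ℓ.symm (p - Y x))) := by
  have hint : ∀ y, cexp (-(I * ((inner ℝ p y / ħ : ℝ) : ℂ))) *
      lowerMetaplectic ħ ℓ Y f (x + (1 / 2 : ℝ) • y) *
      (starRingEnd ℂ) (lowerMetaplectic ħ ℓ Y f (x - (1 / 2 : ℝ) • y)) =
      cexp (-(I * ((inner ℝ (ℓ.symm (p - Y x)) (ℓ y) / ħ : ℝ) : ℂ))) *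
        f (ℓ x + (1 / 2 : ℝ) • ℓ y) * (starRingEnd ℂ) (f (ℓ x - (1 / 2 : ℝ) • ℓ y)) := by
    intro y
    have hph : cexp (-(I * ((inner ℝ p y / ħ : ℝ) : ℂ))) *
        cexp (-(I * ((-(inner ℝ (Y (x + (1 / 2 : ℝ) • y)) (x + (1 / 2 : ℝ) • y) / (2 * ħ)) : ℝ) :
          ℂ))) *
        cexp (I * ((-(inner ℝ (Y (x - (1 / 2 : ℝ) • y)) (x - (1 / 2 : ℝ) • y) / (2 * ħ)) : ℝ) :
          ℂ)) = cexp (-(I * ((inner ℝ (ℓ.symm (p - Y x)) (ℓ y) / ħ : ℝ) : ℂ))) := by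
      rw [← Complex.exp_add, ← Complex.exp_add, ← hℓ, ℓ.apply_symm_apply]
      congr 1
      have h1 : inner ℝ (Y y) x = inner ℝ (Y x) y := by rw [hY, real_inner_comm]
      simp only [map_add, map_sub, map_smul, inner_add_left, inner_sub_left, inner_add_right,
        inner_sub_right, inner_smul_left, inner_smul_right, h1]
      push_cast
      simp
      ring
    simp only [lowerMetaplectic, map_mul, ← Complex.exp_conj, map_neg, Complex.conj_I,
      Complex.conj_ofReal, neg_mul, neg_neg, map_add, map_sub, map_smul]
    simp only [map_add, map_sub, map_smul] at hph
    rw [← hph]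
    ring
  have hmap : ∀ g : ConfigSpace n → ℂ, ∫ y, g (ℓ y) =
      (|(LinearMap.det (ℓ : ConfigSpace n →ₗ[ℝ] ConfigSpace n))⁻¹| : ℝ) * ∫ y, g y := by
    intro g
    have h := integral_map_equiv (μ := volume) ℓ.toHomeomorph.toMeasurableEquiv g
    have h2 : Measure.map ℓ.toHomeomorph.toMeasurableEquiv volume = _ :=
      map_continuousLinearEquiv_volume ℓ
    rw [h2, integral_smul_measure, ENNReal.toReal_ofReal (abs_nonneg _), Complex.real_smul] at h
    exact h.symm
  simp only [wigner, wignerMoyal, phasePoint_pos, phasePoint_mom, hint]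
  rw [hmap fun y => cexp (-(I * ((inner ℝ (ℓ.symm (p - Y x)) y / ħ : ℝ) : ℂ))) *
        f (ℓ x + (1 / 2 : ℝ) • y) * (starRingEnd ℂ) (f (ℓ x - (1 / 2 : ℝ) • y)),
    mul_left_comm, re_ofReal_mul]

end Covariance

/-! ### The quadratic form in Williamson coordinates, and Hardy's principle for it -/

section Williamson

open Matrix

variable {n : ℕ}

/-- Both sides are the squared modulus of the k-th coordinate of A(x + ip). The conjugate form
matches the parameter w = x - ip, on which the Fourier-Laplace transform depends holomorphically. -/
theorem realify_mulVec_sq_add_sq (A : Matrix (Fin n) (Fin n) ℂ) (x p : ConfigSpace n)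
    (k : Fin n) :
    ((realify A).mulVec (Sum.elim x p) (Sum.inl k)) ^ 2 +
        ((realify A).mulVec (Sum.elim x p) (Sum.inr k)) ^ 2 =
      ‖∑ j, (starRingEnd ℂ) (A k j) * ((x j : ℂ) - I * p j)‖ ^ 2 := by
  have h : ∑ j, (starRingEnd ℂ) (A k j) * ((x j : ℂ) - I * p j) =
      (starRingEnd ℂ) (∑ j, A k j * ((x j : ℂ) + I * p j)) := by
    rw [map_sum]
    exact Finset.sum_congr rfl fun j _ => by
      simp only [map_mul, map_add, Complex.conj_ofReal, Complex.conj_I]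
      ring
  rw [h, RCLike.norm_conj, Complex.sq_norm, normSq_apply, re_sum, im_sum]
  simp [realify, mulVec, dotProduct, Fintype.sum_sum_type, Finset.sum_add_distrib]
  simp only [sub_eq_add_neg]
  ring

/-- In the coordinates U*(x + ip) the form is diagonal with nonnegative terms, and only the k-th is
kept. -/
theorem le_quadForm_of_williamson {M T : Matrix (Fin n ⊕ Fin n) (Fin n ⊕ Fin n) ℝ}
    {U : Matrix (Fin n) (Fin n) ℂ} {d : Fin n → ℝ} (hd : ∀ i, 0 < d i)
    (h : Tᵀ * M * T = realify U * fromBlocks (diagonal d) 0 0 (diagonal d) * (realify U)ᵀ)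
    (k : Fin n) (x p : ConfigSpace n) (z : PhaseSpace n)
    (hz : (z : Fin n ⊕ Fin n → ℝ) = T.mulVec (Sum.elim x p)) :
    d k * ‖∑ j, U j k * ((x j : ℂ) - I * p j)‖ ^ 2 ≤ quadForm M z := by
  set y := (realify Uᴴ).mulVec (Sum.elim x p) with hy
  have hq : quadForm M z = ∑ i, d i * (y (Sum.inl i) ^ 2 + y (Sum.inr i) ^ 2) := by
    rw [quadForm_eq, hz, mulVec_mulVec, dotProduct_mulVec, ← vecMul_transpose, vecMul_vecMul,
      ← Matrix.mul_assoc, h, ← dotProduct_mulVec, ← mulVec_mulVec, ← realify_conjTranspose, ← hy,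
      ← mulVec_mulVec, dotProduct_mulVec, ← mulVec_transpose, ← realify_conjTranspose, ← hy]
    simp only [dotProduct, Fintype.sum_sum_type, mulVec, fromBlocks, diagonal]
    simp [mul_add, Finset.sum_add_distrib]
    congr 1 <;> exact Finset.sum_congr rfl fun i _ => by ring
  rw [hq]
  have hk := realify_mulVec_sq_add_sq Uᴴ x p k
  simp only [conjTranspose_apply, RCLike.star_def, Complex.conj_conj] at hk
  rw [← hk]
  exact Finset.single_le_sum (f := fun i => d i * (y (Sum.inl i) ^ 2 + y (Sum.inr i) ^ 2))
    (fun i _ => mul_nonneg (hd i).le (by positivity)) (Finset.mem_univ k)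

theorem sum_norm_sq_col_of_mem_unitaryGroup {U : Matrix (Fin n) (Fin n) ℂ}
    (hU : U ∈ unitaryGroup (Fin n) ℂ) (k : Fin n) : ∑ j, ‖U j k‖ ^ 2 = 1 := by
  have h := congrFun (congrFun (mem_unitaryGroup_iff'.1 hU) k) k
  rw [one_apply_eq, mul_apply] at h
  have h2 : ∀ j, star U k j * U j k = ((‖U j k‖ ^ 2 : ℝ) : ℂ) := fun j => by
    rw [star_apply, RCLike.star_def, mul_comm, Complex.mul_conj, Complex.normSq_eq_norm_sq]
  simp only [h2, ← ofReal_sum] at h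
  exact_mod_cast h

/-- Only the lower triangular factor is carried over to the wave function; the k-th column of U
serves as the unit vector giving the direction of fast decay. -/
theorem hardy_of_williamson {ħ : ℝ} (hħ : 0 < ħ) {f : ConfigSpace n → ℂ} (hf : MemLp f 2)
    {M : Matrix (Fin n ⊕ Fin n) (Fin n ⊕ Fin n) ℝ} {L Y : Matrix (Fin n) (Fin n) ℝ}
    {U : Matrix (Fin n) (Fin n) ℂ} {d : Fin n → ℝ} (hL : L.PosDef) (hY : Yᵀ = Y)
    (hU : U ∈ unitaryGroup (Fin n) ℂ) (hd : ∀ i, 0 < d i)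
    (h : (lowerSymplectic L Y)ᵀ * M * lowerSymplectic L Y =
      realify U * fromBlocks (diagonal d) 0 0 (diagonal d) * (realify U)ᵀ)
    {C : ℝ} (hC : 0 ≤ C) (hW : ∀ z, wigner ħ f z ≤ C * Real.exp (-(1 / ħ) * quadForm M z))
    {k : Fin n} (hk : 1 < d k) : ∀ᵐ u, f u = 0 := by
  have hLu := (isUnit_iff_isUnit_det L).1 hL.isUnit
  let e : ConfigSpace n ≃ₗ[ℝ] ConfigSpace n :=
    (WithLp.linearEquiv 2 ℝ _).trans ((toLin'OfInv (nonsing_inv_mul L hLu)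
      (mul_nonsing_inv L hLu)).trans (WithLp.linearEquiv 2 ℝ _).symm)
  let ℓ : ConfigSpace n ≃L[ℝ] ConfigSpace n := e.toContinuousLinearEquiv
  let Y' : ConfigSpace n →L[ℝ] ConfigSpace n := Matrix.toEuclideanCLM (𝕜 := ℝ) Y
  have hℓ : ∀ u, (ℓ u : Fin n → ℝ) = L.mulVec u := fun u => rfl
  have hℓs : ∀ u, (ℓ.symm u : Fin n → ℝ) = L⁻¹.mulVec u := fun u => rfl
  have hY' : ∀ u, (Y' u : Fin n → ℝ) = Y.mulVec u := fun u => rfl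
  have hsymm : ∀ (A : Matrix (Fin n) (Fin n) ℝ) (a b : Fin n → ℝ), Aᵀ = A →
      b ⬝ᵥ A.mulVec a = A.mulVec b ⬝ᵥ a := fun A a b hA => by
    rw [dotProduct_mulVec, ← mulVec_transpose, hA]
  apply ae_eq_zero_of_lowerMetaplectic (ħ := ħ) ℓ Y'
  set c := |(LinearMap.det (ℓ : ConfigSpace n →ₗ[ℝ] ConfigSpace n))⁻¹| with hc
  refine ae_eq_zero_of_wigner_le hħ (memLp_lowerMetaplectic ℓ Y' hf)
    (sum_norm_sq_col_of_mem_unitaryGroup hU k) hk (mul_nonneg (abs_nonneg _) hC : 0 ≤ c * C)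
    fun x p => ?_
  rw [wigner_lowerMetaplectic]
  · rw [mul_assoc]
    refine mul_le_mul_of_nonneg_left ((hW _).trans ?_) (abs_nonneg _)
    gcongr
    rw [neg_mul, neg_le_neg_iff, one_div_mul_eq_div]
    refine div_le_div_of_nonneg_right ?_ hħ.le
    refine le_quadForm_of_williamson hd h k x p _ ?_
    rw [lowerSymplectic, fromBlocks_mulVec]
    change Sum.elim (ℓ x : Fin n → ℝ) (ℓ.symm (p - Y' x) : Fin n → ℝ) = _
    rw [hℓ, hℓs, WithLp.ofLp_sub, hY']
    congr 1
    · simp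
    · simp [mulVec_sub, neg_mulVec]
      abel
  · intro a b
    simp only [EuclideanSpace.inner_eq_star_dotProduct, star_trivial, hℓ]
    exact hsymm L _ _ hL.transpose_eq
  · intro a b
    simp only [EuclideanSpace.inner_eq_star_dotProduct, star_trivial, hY']
    exact hsymm Y _ _ hY

end Williamson

/-! ### The main theorem -/

theorem theorem3 (n : ℕ) (hn : 0 < n) (ħ : ℝ) (hħ : 0 < ħ)
    (M : Matrix (Fin n ⊕ Fin n) (Fin n ⊕ Fin n) ℝ) (hM : M.PosDef) :
    -- the largest symplectic eigenvalue `l` of `M`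
    ∃ l : ℝ, IsGreatest (symplecticEigenvalues M) l ∧
      -- Hardy's uncertainty principle; `h = 2 * π * ħ`
      (∀ ψ : MeasureTheory.Lp ℂ 2 (MeasureTheory.volume : MeasureTheory.Measure (ConfigSpace n)),
        ψ ≠ 0 →
        (∃ C : ℝ, 0 < C ∧
          ∀ z : PhaseSpace n, wigner ħ ψ z ≤ C * Real.exp (-(1 / ħ) * quadForm M z)) →
        (∀ c : Set (PhaseSpace n) → ℝ≥0∞,
          (IsSymplecticCapacity c ∨ IsLinearSymplecticCapacity c) →
          ENNReal.ofReal ((2 * Real.pi * ħ) / 2) ≤ c (wignerEllipsoid ((ħ / 2) • M⁻¹)) ∧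
          ENNReal.ofReal ((2 * Real.pi * ħ) / 2) ≤ c (ellipsoidB ħ M)) ∧
        l ≤ 1) ∧
      -- the three forms of the conclusion are equivalent, for every `M` and every capacity
      (∀ c : Set (PhaseSpace n) → ℝ≥0∞,
        (IsSymplecticCapacity c ∨ IsLinearSymplecticCapacity c) →
        (ENNReal.ofReal ((2 * Real.pi * ħ) / 2) ≤ c (wignerEllipsoid ((ħ / 2) • M⁻¹)) ↔
          ENNReal.ofReal ((2 * Real.pi * ħ) / 2) ≤ c (ellipsoidB ħ M)) ∧
        (ENNReal.ofReal ((2 * Real.pi * ħ) / 2) ≤ c (ellipsoidB ħ M) ↔ l ≤ 1)) := by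
  -- The diagonalizing symplectic matrix is T · `realify U`: the second factor is orthogonal and
  -- commutes with J, hence is symplectic.
  obtain ⟨L, Y, U, d, hL, hY, hU, hd, hW⟩ := hM.exists_williamson
  have hSJ : (Matrix.lowerSymplectic L Y * Matrix.realify U).transpose * Matrix.stdJ (Fin n) *
      (Matrix.lowerSymplectic L Y * Matrix.realify U) = Matrix.stdJ (Fin n) := by
    have hT := Matrix.lowerSymplectic_symplectic ((Matrix.isUnit_iff_isUnit_det L).1 hL.isUnit)
      hL.transpose_eq hY
    calc _ = (Matrix.realify U).transpose * ((Matrix.lowerSymplectic L Y).transpose *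
          Matrix.stdJ (Fin n) * Matrix.lowerSymplectic L Y) * Matrix.realify U := by
          rw [Matrix.transpose_mul]; noncomm_ring
      _ = Matrix.stdJ (Fin n) := by
          rw [hT, mul_assoc, ← Matrix.realify_commute_stdJ, ← mul_assoc,
            ← Matrix.realify_conjTranspose, ← Matrix.realify_mul, ← Matrix.star_eq_conjTranspose,
            Matrix.mem_unitaryGroup_iff'.1 hU, Matrix.realify_one, one_mul]
  have hSM : (Matrix.lowerSymplectic L Y * Matrix.realify U).transpose * M *
      (Matrix.lowerSymplectic L Y * Matrix.realify U) =
        Matrix.fromBlocks (Matrix.diagonal d) 0 0 (Matrix.diagonal d) := by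
    have hUU : (Matrix.realify U).transpose * Matrix.realify U = 1 := by
      rw [← Matrix.realify_conjTranspose, ← Matrix.realify_mul, ← Matrix.star_eq_conjTranspose,
        Matrix.mem_unitaryGroup_iff'.1 hU, Matrix.realify_one]
    calc _ = (Matrix.realify U).transpose * ((Matrix.lowerSymplectic L Y).transpose * M *
          Matrix.lowerSymplectic L Y) * Matrix.realify U := by
          rw [Matrix.transpose_mul]; noncomm_ring
      _ = ((Matrix.realify U).transpose * Matrix.realify U) *
          Matrix.fromBlocks (Matrix.diagonal d) 0 0 (Matrix.diagonal d) *
          ((Matrix.realify U).transpose * Matrix.realify U) := by rw [hW]; noncomm_ring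
      _ = _ := by rw [hUU, one_mul, mul_one]
  have : Nonempty (Fin n) := ⟨⟨0, hn⟩⟩
  obtain ⟨k, hk⟩ := Finite.exists_max d
  have hcap : ∀ c : Set (PhaseSpace n) → ℝ≥0∞,
      (IsSymplecticCapacity c ∨ IsLinearSymplecticCapacity c) →
      (ENNReal.ofReal ((2 * Real.pi * ħ) / 2) ≤ c (ellipsoidB ħ M) ↔ d k ≤ 1) := by
    intro c hc
    -- The comparison is πħ ≤ πħ/d k.
    rw [capacity_ellipsoidB hħ hSJ hSM hd hk
      (hc.elim IsSymplecticCapacity.isLinearSymplecticCapacity id),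
      ENNReal.ofReal_le_ofReal_iff (by have := Real.pi_pos; have := hd k; positivity),
      show 2 * Real.pi * ħ / 2 = Real.pi * ħ by ring, mul_le_mul_iff_right₀ Real.pi_pos,
      le_div_iff₀ (hd k), mul_le_iff_le_one_right hħ]
  refine ⟨d k, ?_, ?_, fun c hc => ⟨by rw [wignerEllipsoid_eq_ellipsoidB hħ hM], hcap c hc⟩⟩
  · rw [symplecticEigenvalues_eq_range hSJ hSM hd]
    exact ⟨⟨k, rfl⟩, by rintro _ ⟨i, rfl⟩; exact hk i⟩
  · rintro ψ hψ ⟨C, hC, hWψ⟩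
    have hle : d k ≤ 1 := by
      by_contra! hlt
      exact hψ ((MeasureTheory.Lp.eq_zero_iff_ae_eq_zero).2
        (hardy_of_williamson hħ (MeasureTheory.Lp.memLp ψ) hL hY hU hd hW hC.le hWψ hlt))
    refine ⟨fun c hc => ?_, hle⟩
    rw [wignerEllipsoid_eq_ellipsoidB hħ hM, and_self]
    exact (hcap c hc).2 hle
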